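/- **Lemma (ramification structure of the tower).** Let $p$ be an odd prime, $K=\mathbb F_{p^2}$, and $i\in K$ with $i^2=-1$. Let $T_0=K(x_0)$ be the rational function field and, for $j\ge 0$, $T_{j+1}=T_j(x_{j+1})$ with $$x_{j+1}^2=\frac{x_j^2+1}{2x_j}.$$ For $\alpha\in K\cup\{\infty\}$ let $P^0_\alpha$ be the unique place of $T_0/K$ with $x_0(P^0_\alpha)=\alpha$, and let $\mathcal R=\{P^0_\infty,P^0_0,P^0_i,P^0_{-i},P^0_1,P^0_{-1}\}$. We write $v_P$ for the normalized discrete valuation at a place $P$, $Q|P$ if the place $Q$ lies over $P$, and $e(Q|P)$ for the ramification index. Then for every $j\ge 0$ the following holds. (a) For $\alpha\in\{\infty,0,i,-i\}$ there is a unique place $P^j_\alpha$ of $T_j/K$ over $P^0_\alpha$. If $j\ge1$, then $e(P^j_\alpha|P^{j-1}_\alpha)=2$. Moreover $v_{P^j_\infty}(x_j)=-1$; $v_{P^j_0}(x_j)$ is $1$ if $j=0$ and $-1$ if $j\ge 1$; and $v_{P^j_{\pm i}}(x_j)$ is $0$ if $j=0$, $1$ if $j=1$, and $-1$ if $j\ge2$.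 (b) For $\beta\in\{1,-1\}$ there is a unique place $P^j_\beta$ of $T_j/K$ with $x_j(P^j_\beta)=\beta$. If $j\ge1$, then $P^j_{\pm1}|P^{j-1}_1$ and $e(P^j_{\pm1}|P^{j-1}_1)=1$. (c) Let $0\le r\le\lfloor (j-3)/2\rfloor$ (so $j\ge3$ and $r<j-1$). There are finitely many places of $T_j/K$ over the place $P^r_{-1}$ of $T_r/K$, and the sum of their degrees is $2^{r+2}$. For each such place $Q$, with restriction $Q'$ to $T_{j-1}$ (a place over $P^r_{-1}$), we have $e(Q|Q')=2$ and $v_Q(x_j)=-1$. (d) Let $\lfloor (j-1)/2\rfloor\le r\le j-2$ (so $j\ge2$ and $r\ge0$). There are finitely many places of $T_j/K$ over $P^r_{-1}$, and the sum of their degrees is $2^{j-r}$. For each such place $Q$, with restriction $Q'$ to $T_{j-1}$ (a place over $P^r_{-1}$), we have $e(Q|Q')=1$, and $v_Q(x_j)=-2^{2r-j+2}$ if $r\le j-3$, while $v_Q(x_j)=2^{j-2}$ if $r=j-2$. (e) For $\beta\in\{i,-i\}$ there is a unique place $Q^j_\beta$ of $T_j/K$ with $x_j(Q^j_\beta)=\beta$.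 If $j\ge1$, then $Q^j_{\pm i}|P^{j-1}_{-1}$ and $e(Q^j_{\pm i}|P^{j-1}_{-1})=1$, and $Q^j_i$, $Q^j_{-i}$ are the only places of $T_j/K$ over $P^{j-1}_{-1}$. (f) The places of $T_j/K$ over $\mathcal R$ are exactly the following: $P^j_\alpha$ for $\alpha\in\{\infty,0,i,-i,1,-1\}$; the places over $P^r_{-1}$ for $0\le r\le j-2$; and $Q^j_i$, $Q^j_{-i}$. With the exception of $Q^0_{\pm i}=P^0_{\pm i}$, they are all distinct (in particular, no place lies over $P^r_{-1}$ for two different values of $r\le j-2$). (g) The function $x_j$ has no zeros or poles in $T_j$ outside the set of places over $\mathcal R$. (h) $v_{Q^j_{\pm i}}(x_j^2+1)=2^j$. -/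

import Mathlib

open scoped OnePoint

/-- A place of a field extension `F / K`, given by its valuation ring `O` with `K ⊆ O ⊊ F`. -/
structure Place (K F : Type*) [Field K] [Field F] [Algebra K F] where
  ring : ValuationSubring F
  algebraMap_mem : ∀ c : K, algebraMap K F c ∈ ring
  ne_top : ring ≠ ⊤

namespace Place

section Basic

variable {K F : Type*} [Field K] [Field F] [Algebra K F]

instance algebraRing (P : Place K F) : Algebra K P.ring :=
  ((algebraMap K F).codRestrict P.ring.toSubring P.algebraMap_mem).toAlgebra

/-- The degree of a place: the dimension over `K` of its residue class field. -/
noncomputable def degree (P : Place K F) : ℕ :=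
  Module.finrank K (IsLocalRing.ResidueField P.ring)

/-- `t` is a prime element at `P`: it generates the maximal ideal of the valuation ring. -/
def IsUniformizer (P : Place K F) (t : P.ring) : Prop :=
  IsLocalRing.maximalIdeal P.ring = Ideal.span {t}

/-- `P.HasOrd z n` says that `v_P(z) = n`, where `v_P` is the normalized discrete valuation:
`z = t ^ n * u` with a prime element `t` at `P` and a unit `u` of the valuation ring. -/
def HasOrd (P : Place K F) (z : F) (n : ℤ) : Prop :=
  ∃ (t : P.ring) (u : P.ringˣ), P.IsUniformizer t ∧ z = (t : F) ^ n * ((u : P.ring) : F)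

/-- `P.HasValue z a` says that `z(P) = a` for `a ∈ K ∪ {∞}`: for `a = ∞` the function `z` has a
pole at `P`, and for `a ∈ K` the function `z - a` lies in the maximal ideal at `P`. -/
def HasValue (P : Place K F) (z : F) : OnePoint K → Prop
  | ∞ => z ∉ P.ring
  | (a : K) => z - algebraMap K F a ∈ P.ring.nonunits

end Basic

section Extension

variable {K L : Type*} [Field K] [Field L] [Algebra K L] {E F : IntermediateField K L}

/-- `Q | P` for places `P` of `E` and `Q` of `F`, where `E ⊆ F`: the valuation ring of `P` is
the intersection of the one of `Q` with `E`. -/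
def LiesOver (Q : Place K F) (P : Place K E) : Prop :=
  ∃ h : E ≤ F, Q.ring.comap (IntermediateField.inclusion h : E →+* F) = P.ring

/-- `Q.HasRamificationIndex P e` says that `Q | P`, that the valuation at `P` is discrete, and
that `e(Q|P) = e`, which means `v_Q(z) = e * v_P(z)` for all nonzero `z ∈ E`. -/
def HasRamificationIndex (Q : Place K F) (P : Place K E) (e : ℕ) : Prop :=
  ∃ h : E ≤ F, Q.ring.comap (IntermediateField.inclusion h : E →+* F) = P.ring ∧
    (∃ t, P.IsUniformizer t) ∧
    ∀ (z : E) (n : ℤ), P.HasOrd z n → Q.HasOrd (IntermediateField.inclusion h z) (e * n)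

end Extension

end Place

/-- The value of the valuation at a place is unique. -/
theorem Place.HasOrd.unique {K F : Type*} [Field K] [Field F] [Algebra K F]
    {P : Place K F} {z : F} {n m : ℤ}
    (hn : P.HasOrd z n) (hm : P.HasOrd z m) : n = m := by
  obtain ⟨t, u, ht, rfl⟩ := hn
  obtain ⟨s, w, hs, h⟩ := hm
  obtain ⟨c, hc⟩ : Associated t s := by
    rw [← Ideal.span_singleton_eq_span_singleton, ← ht, ← hs]
  subst hc
  have val1 : ∀ v : P.ringˣ, P.ring.valuation ((v : P.ring) : F) = 1 := fun v =>
    (P.ring.valuation_unit v)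
  have htm : t ∈ IsLocalRing.maximalIdeal P.ring := by
    rw [ht]; exact Ideal.mem_span_singleton_self t
  have hlt : P.ring.valuation (t : F) < 1 := (P.ring.valuation_lt_one_iff t).1 htm
  have hne : (t : F) ≠ 0 := by
    intro h0
    have ht0 : t = 0 := Subtype.ext h0
    apply P.ne_top
    rw [eq_top_iff]
    intro y _
    rcases P.ring.mem_or_inv_mem y with hy | hy
    · exact hy
    · by_contra hy'
      have : (⟨y⁻¹, hy⟩ : P.ring) ∈ IsLocalRing.maximalIdeal P.ring := by
        rw [IsLocalRing.mem_maximalIdeal, mem_nonunits_iff]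
        intro hu
        obtain ⟨v, hv⟩ := hu
        have h1 := congrArg (fun a : P.ring => (a : F)) (v.mul_inv)
        rw [hv] at h1
        simp only [MulMemClass.coe_mul, OneMemClass.coe_one] at h1
        apply hy'
        have : y = (((v⁻¹ : P.ringˣ) : P.ring) : F) := by
          have hy0 : y ≠ 0 := by rintro rfl; exact hy' (zero_mem _)
          field_simp at h1
          exact h1.symm
        rw [this]; exact Subtype.property _
      rw [ht, ht0, Ideal.mem_span_singleton, zero_dvd_iff] at this
      have h2 := congrArg (fun a : P.ring => (a : F)) this
      simp at h2
      exact hy' (h2 ▸ zero_mem _)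
  have h3 := congrArg P.ring.valuation h
  have hpos : 0 < P.ring.valuation (t : F) := (Valuation.pos_iff _).2 hne
  simp only [map_mul, map_zpow₀, val1, mul_one, MulMemClass.coe_mul] at h3
  exact zpow_right_injective₀ hpos hlt.ne h3

/-- The field `T_j = K(x_0, …, x_j)` inside an extension field `L` of `K`. -/
def towerField (K : Type*) {L : Type*} [Field K] [Field L] [Algebra K L] (x : ℕ → L) (j : ℕ) :
    IntermediateField K L :=
  IntermediateField.adjoin K (x '' Set.Iic j)

/-- The function `x_j` as an element of `T_j`. -/
def towerGen (K : Type*) {L : Type*} [Field K] [Field L] [Algebra K L] (x : ℕ → L) (j : ℕ) :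
    towerField K x j :=
  ⟨x j, IntermediateField.subset_adjoin K _ ⟨j, Set.mem_Iic.2 le_rfl, rfl⟩⟩

/-- The values `∞, 0, i, -i` of `x_0` at the totally ramified places. -/
def totalValues {K : Type*} [Field K] (i : K) : Set (OnePoint K) :=
  {∞, ((0 : K) : OnePoint K), (i : OnePoint K), ((-i : K) : OnePoint K)}

/-- The values `∞, 0, i, -i, 1, -1` of `x_0` at the places in `R`. -/
def specialValues {K : Type*} [Field K] (i : K) : Set (OnePoint K) :=
  totalValues i ∪ {((1 : K) : OnePoint K), ((-1 : K) : OnePoint K)}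

/-! Every step of the tower is a quadratic extension `F = E(y)`, `y² = u`, with 2 invertible, and
its behaviour over a place `P` depends on the parity of `v_P(u)`. If `v_P(u)` is odd, there is one
place `Q` above, with `e = 2`, the same degree and `v_Q(y) = v_P(u)`. If `v_P(u)` is even, the
places above are unramified, their degrees sum to `2 deg P`, and `v_Q(y) = v_P(u)/2`. Both follow by
writing elements of `F` as `a + b y`: in the odd case the two terms never have equal nonzero value
(`IsQuadratic.val_add`); in the even case `y` is rescaled to a unit and the norm `a² - b² u` is
used.

It remains to follow `v(u)` for `u = (g² + 1)/(2g) = (g + 1/g)/2`. If `v(g) = n ≠ 0`, then `v(u) =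
-|n|`. If `g = ±i` at the place, then `v(u) = v(g² + 1)`. If `c⁴ = 1`, then `u - c² = (g -
c²)²/(2g)`, so `y = ±c` exactly over `g = c²`, and the order of vanishing doubles at each step.

Over `x_0 ∈ {∞, 0, i, -i}` the order of `u` is 1 or -1 at the bottom and -1 from then on, so every
step ramifies. Since the pole of `x_0` gives `v(u) = -1` on all levels, no `u` is a square and every
step really has degree two.

Over `x_0 = ±1` the values can only follow `1 → 1`, `1 → -1`, `-1 → ±i`, `±i → 0 → ∞ → ∞`. Doubling
gives `v(x_{r+1}² + 1) = 2^{r+1}` at the two places over `P^r_{-1}`. After that the order of `x` is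
`2^r`, then `-2^{r-1}`, `-2^{r-2}`, and so on: the steps are unramified and double the degree sum
until the order reaches an odd number, and from then on every step ramifies with order -1
(`IsTower.liesOver_main`).

The set `{∞, 0, ±i, ±1}` contains all values of `x_j` that can precede one of its members, which
yields the completeness of the list and the absence of other zeros and poles. -/

namespace Place

/-! ### Orders at a place in terms of its multiplicative valuation -/

section Valuation

variable {K F : Type*} [Field K] [Field F] [Algebra K F]

theorem ext {P Q : Place K F} (h : P.ring = Q.ring) : P = Q := by
  cases P; cases Q; cases h; rfl

/-- The valuation attached to a place. -/
noncomputable abbrev val (P : Place K F) : Valuation F P.ring.ValueGroup := P.ring.valuation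

variable {P Q : Place K F} {z w t : F} {m n : ℤ}

theorem mem_ring_iff : z ∈ P.ring ↔ P.val z ≤ 1 := (P.ring.valuation_le_one_iff z).symm

theorem mem_nonunits_iff : z ∈ P.ring.nonunits ↔ P.val z < 1 := P.ring.mem_nonunits_iff

theorem val_algebraMap_le (P : Place K F) (c : K) : P.val (algebraMap K F c) ≤ 1 :=
  mem_ring_iff.1 (P.algebraMap_mem c)

theorem val_algebraMap (P : Place K F) {c : K} (hc : c ≠ 0) : P.val (algebraMap K F c) = 1 := by
  refine le_antisymm (P.val_algebraMap_le c) ?_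
  have h := P.val_algebraMap_le c⁻¹
  rw [map_inv₀, map_inv₀] at h
  have hc' : algebraMap K F c ≠ 0 := by simpa using hc
  exact (inv_le_one₀ ((Valuation.pos_iff _).2 hc')).1 h

theorem ext_val (h : ∀ z, P.val z ≤ 1 ↔ Q.val z ≤ 1) : P = Q :=
  ext (ValuationSubring.ext _ _ fun z => by rw [mem_ring_iff, mem_ring_iff, h])

theorem hasValue_coe {a : K} :
    P.HasValue z (a : OnePoint K) ↔ P.val (z - algebraMap K F a) < 1 := mem_nonunits_iff

theorem hasValue_infty : P.HasValue z ∞ ↔ 1 < P.val z := by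
  rw [← not_le, ← mem_ring_iff]; rfl

/-- `t` has the largest value smaller than one. -/
def IsUnif (P : Place K F) (t : F) : Prop :=
  P.val t < 1 ∧ ∀ z, P.val z < 1 → P.val z ≤ P.val t

/-- Divisibility in a valuation ring is comparison of values, so a generator of the maximal ideal is
an element of largest value below one. -/
theorem isUniformizer_iff {t : P.ring} : P.IsUniformizer t ↔ P.IsUnif (t : F) := by
  constructor
  · intro h
    have key : ∀ z : P.ring, P.val (z : F) < 1 → P.val (z : F) ≤ P.val (t : F) := by
      intro z hz
      have : z ∈ IsLocalRing.maximalIdeal P.ring := (P.ring.valuation_lt_one_iff z).2 hz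
      rw [h, Ideal.mem_span_singleton] at this
      obtain ⟨c, rfl⟩ := this
      simpa using mul_le_mul_right (P.ring.valuation_le_one c) (P.val (t : F))
    refine ⟨(P.ring.valuation_lt_one_iff t).1 ?_, fun z hz => ?_⟩
    · rw [h]; exact Ideal.mem_span_singleton_self t
    · exact key ⟨z, mem_ring_iff.2 hz.le⟩ hz
  · rintro ⟨h1, h2⟩
    refine Ideal.ext fun z => ?_
    rw [P.ring.valuation_lt_one_iff, Ideal.mem_span_singleton]
    constructor
    · intro hz
      obtain ⟨a, ha⟩ := (P.ring.valuation_le_iff _ _).1 (h2 _ hz)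
      exact ⟨a, Subtype.ext (by simp [← ha, mul_comm])⟩
    · rintro ⟨c, rfl⟩
      have := mul_le_mul_right (P.ring.valuation_le_one c) (P.val (t : F))
      rw [mul_one] at this
      simpa using this.trans_lt h1

theorem exists_val_lt_one (P : Place K F) : ∃ z, z ≠ 0 ∧ P.val z < 1 := by
  by_contra! h
  refine P.ne_top (eq_top_iff.2 fun z _ => ?_)
  rw [mem_ring_iff]
  by_contra! hz
  have hz0 : z ≠ 0 := by rintro rfl; simp at hz
  have := h z⁻¹ (inv_ne_zero hz0)
  rw [map_inv₀] at this
  exact absurd (inv_lt_one_of_one_lt₀ hz) (not_lt.2 this)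

theorem IsUnif.pos (ht : P.IsUnif t) : 0 < P.val t := by
  obtain ⟨z, hz, h⟩ := P.exists_val_lt_one
  exact ((Valuation.pos_iff _).2 hz).trans_le (ht.2 z h)

theorem IsUnif.ne_zero (ht : P.IsUnif t) : t ≠ 0 := (Valuation.pos_iff _).1 ht.pos

theorem IsUnif.val_eq (ht : P.IsUnif t) {s : F} (hs : P.IsUnif s) : P.val t = P.val s :=
  le_antisymm (hs.2 _ ht.1) (ht.2 _ hs.1)

theorem hasOrd_iff : P.HasOrd z n ↔ ∃ t, P.IsUnif t ∧ P.val z = P.val t ^ n := by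
  constructor
  · rintro ⟨t, u, ht, rfl⟩
    refine ⟨t, isUniformizer_iff.1 ht, ?_⟩
    rw [map_mul, map_zpow₀, P.ring.valuation_unit, mul_one]
  · rintro ⟨t, ht, h⟩
    have ht0 : t ^ n ≠ 0 := zpow_ne_zero _ ht.ne_zero
    have hu : P.val (z / t ^ n) = 1 := by
      rw [map_div₀, map_zpow₀, h, div_self]
      exact zpow_ne_zero _ ht.pos.ne'
    obtain ⟨u, hu'⟩ :=
      (P.ring.valuation_eq_one_iff ⟨z / t ^ n, mem_ring_iff.2 hu.le⟩).2 hu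
    refine ⟨⟨t, mem_ring_iff.2 ht.1.le⟩, u, isUniformizer_iff.2 ht, ?_⟩
    rw [hu']
    field_simp

/-- All prime elements have the same value, so orders can be computed with any fixed one; the
arithmetic of orders becomes that of integer powers of one value. -/
theorem IsUnif.hasOrd_iff (ht : P.IsUnif t) : P.HasOrd z n ↔ P.val z = P.val t ^ n := by
  rw [Place.hasOrd_iff]
  exact ⟨fun ⟨s, hs, h⟩ => by rw [h, hs.val_eq ht], fun h => ⟨t, ht, h⟩⟩

theorem HasOrd.exists_isUnif (h : P.HasOrd z n) : ∃ t, P.IsUnif t :=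
  let ⟨t, ht, _⟩ := hasOrd_iff.1 h; ⟨t, ht⟩

theorem HasOrd.ne_zero (h : P.HasOrd z n) : z ≠ 0 := by
  obtain ⟨t, ht, h⟩ := hasOrd_iff.1 h
  rintro rfl
  rw [map_zero] at h
  exact zpow_ne_zero _ ht.pos.ne' h.symm

theorem HasOrd.mul (hz : P.HasOrd z n) (hw : P.HasOrd w m) : P.HasOrd (z * w) (n + m) := by
  obtain ⟨t, ht⟩ := hz.exists_isUnif
  rw [ht.hasOrd_iff] at *
  rw [map_mul, hz, hw, zpow_add₀ ht.pos.ne']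

theorem HasOrd.inv (hz : P.HasOrd z n) : P.HasOrd z⁻¹ (-n) := by
  obtain ⟨t, ht⟩ := hz.exists_isUnif
  rw [ht.hasOrd_iff] at *
  rw [map_inv₀, hz, zpow_neg]

theorem HasOrd.div (hz : P.HasOrd z n) (hw : P.HasOrd w m) : P.HasOrd (z / w) (n - m) := by
  rw [div_eq_mul_inv, sub_eq_add_neg]; exact hz.mul hw.inv

theorem HasOrd.pow (hz : P.HasOrd z n) (k : ℕ) : P.HasOrd (z ^ k) (k * n) := by
  obtain ⟨t, ht⟩ := hz.exists_isUnif
  rw [ht.hasOrd_iff] at *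
  rw [map_pow, hz, mul_comm, zpow_mul, zpow_natCast]

theorem HasOrd.of_val_eq (hz : P.HasOrd z n) (h : P.val w = P.val z) : P.HasOrd w n := by
  obtain ⟨t, ht⟩ := hz.exists_isUnif
  rw [ht.hasOrd_iff] at *
  rw [h, hz]

theorem IsUnif.hasOrd_zero (ht : P.IsUnif t) (h : P.val z = 1) : P.HasOrd z 0 := by
  rw [ht.hasOrd_iff, h, zpow_zero]

theorem HasOrd.val_lt_one_iff (hz : P.HasOrd z n) : P.val z < 1 ↔ 0 < n := by
  obtain ⟨t, ht, h⟩ := hasOrd_iff.1 hz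
  rw [h, ← zpow_zero (P.val t), zpow_lt_zpow_iff_right_of_lt_one₀ ht.pos ht.1]

theorem HasOrd.one_lt_val_iff (hz : P.HasOrd z n) : 1 < P.val z ↔ n < 0 := by
  obtain ⟨t, ht, h⟩ := hasOrd_iff.1 hz
  rw [h, ← zpow_zero (P.val t), zpow_lt_zpow_iff_right_of_lt_one₀ ht.pos ht.1]

theorem HasOrd.val_eq_one_iff (hz : P.HasOrd z n) : P.val z = 1 ↔ n = 0 := by
  have h1 := hz.val_lt_one_iff
  have h2 := hz.one_lt_val_iff
  constructor
  · intro h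
    rw [h] at h1 h2
    simp at h1 h2
    omega
  · rintro rfl
    exact le_antisymm (not_lt.1 fun h => by simpa using h2.1 h)
      (not_lt.1 fun h => by simpa using h1.1 h)

/-- The valuation at the place is discrete. -/
def IsDiscrete (P : Place K F) : Prop := ∀ z, z ≠ 0 → ∃ n, P.HasOrd z n

/-- This is how discreteness is obtained throughout: exhibit one element of value below one whose
powers exhaust the nonzero values. The value of `t` cannot be zero, since then every nonzero element
would have value one, against the nontriviality of the place. -/
theorem isUnif_of_forall (ht : P.val t < 1) (h : ∀ z, z ≠ 0 → ∃ n : ℤ, P.val z = P.val t ^ n) :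
    P.IsUnif t := by
  have ht0 : 0 < P.val t := by
    rw [zero_lt_iff]
    intro h0
    obtain ⟨z, hz, hz1⟩ := P.exists_val_lt_one
    obtain ⟨n, hn⟩ := h z hz
    rw [h0] at hn
    rcases eq_or_ne n 0 with rfl | hn0
    · rw [zpow_zero] at hn; exact hz1.ne hn
    · rw [zero_zpow _ hn0] at hn
      exact hz ((Valuation.zero_iff _).1 hn)
  refine ⟨ht, fun z hz => ?_⟩
  rcases eq_or_ne z 0 with rfl | hz0
  · simp
  obtain ⟨n, hn⟩ := h z hz0
  rw [hn] at hz ⊢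
  rw [← zpow_zero (P.val t), zpow_lt_zpow_iff_right_of_lt_one₀ ht0 ht] at hz
  conv_rhs => rw [← zpow_one (P.val t)]
  rw [zpow_le_zpow_iff_right_of_lt_one₀ ht0 ht]
  omega

theorem isDiscrete_of_forall (ht : P.val t < 1)
    (h : ∀ z, z ≠ 0 → ∃ n : ℤ, P.val z = P.val t ^ n) : P.IsDiscrete := fun z hz =>
  let ⟨n, hn⟩ := h z hz
  ⟨n, (isUnif_of_forall ht h).hasOrd_iff.2 hn⟩

theorem IsDiscrete.exists_isUnif (h : P.IsDiscrete) : ∃ t, P.IsUnif t :=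
  let ⟨_, hn⟩ := h 1 one_ne_zero; hn.exists_isUnif

theorem IsDiscrete.hasOrd_zero (hP : P.IsDiscrete) (h : P.val z = 1) : P.HasOrd z 0 :=
  let ⟨_, ht⟩ := hP.exists_isUnif; ht.hasOrd_zero h

theorem IsUnif.hasOrd_one (ht : P.IsUnif t) : P.HasOrd t 1 := by
  rw [ht.hasOrd_iff, zpow_one]

theorem val_lt_one_of_pow {k : ℕ} (h : P.val (z ^ k) < 1) : P.val z < 1 := by
  by_contra! h1
  rw [map_pow] at h
  exact absurd h (not_lt.2 (one_le_pow₀ h1))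

theorem val_eq_one_of_sq (h : P.val (z ^ 2) = 1) : P.val z = 1 := by
  rw [map_pow] at h
  exact (pow_eq_one_iff_of_nonneg zero_le two_ne_zero).1 h

theorem val_eq_one_of_sub (hz : P.val z = 1) (h : P.val (z - w) < 1) : P.val w = 1 := by
  rw [← hz] at h ⊢
  have := Valuation.map_sub_eq_of_lt_right P.val h
  simpa using this

end Valuation

/-! ### Places of degree one and existence of valuation rings -/

section Degree

variable {K F : Type*} [Field K] [Field F] [Algebra K F]

theorem degree_eq_one {P : Place K F}
    (h : ∀ z, P.val z ≤ 1 → ∃ c : K, P.val (z - algebraMap K F c) < 1) : P.degree = 1 := by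
  have hb : Function.Bijective (algebraMap K (IsLocalRing.ResidueField P.ring)) := by
    refine ⟨(algebraMap K _).injective, fun z => ?_⟩
    obtain ⟨z, rfl⟩ := IsLocalRing.residue_surjective z
    obtain ⟨c, hc⟩ := h z (P.ring.valuation_le_one z)
    refine ⟨c, ?_⟩
    change IsLocalRing.residue _ (algebraMap K P.ring c) = _
    rw [← sub_eq_zero, ← map_sub, IsLocalRing.residue_eq_zero_iff, ← Ideal.neg_mem_iff, neg_sub,
      P.ring.valuation_lt_one_iff]
    exact hc
  have := (LinearEquiv.ofBijective (Algebra.linearMap K (IsLocalRing.ResidueField P.ring))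
    hb).finrank_eq
  rw [degree, ← this, Module.finrank_self]

end Degree

/-- Chevalley's extension theorem for the subring `f(R)` of `F`. The condition on the kernel keeps
the image of `I` a proper ideal of `f(R)`. It produces both the places of the rational function
field and the places over a given one. -/
theorem exists_valuationSubring {R F : Type*} [CommRing R] [Field F] (f : R →+* F) (I : Ideal R)
    (hI : I ≠ ⊤) (hker : RingHom.ker f ≤ I) :
    ∃ B : ValuationSubring F, (∀ r, f r ∈ B) ∧ ∀ r ∈ I, f r ∈ B.nonunits := by
  have hne : I.map f.rangeRestrict ≠ ⊤ := by
    intro h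
    have h1 := Ideal.comap_map_of_surjective _ f.rangeRestrict_surjective I
    rw [h, Ideal.comap_top] at h1
    refine hI (top_le_iff.1 (h1.le.trans (sup_le le_rfl fun r hr => ?_)))
    apply hker
    simpa [Ideal.mem_comap, RingHom.mem_ker, Subtype.ext_iff] using hr
  obtain ⟨B, hB, hI⟩ := Ideal.image_subset_nonunits_valuationSubring _ hne
  refine ⟨B, fun r => hB ⟨r, rfl⟩, fun r hr => hI ⟨f.rangeRestrict r, ?_, rfl⟩⟩
  exact Ideal.mem_map_of_mem _ hr

/-! ### Places lying over one another -/

section Over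

variable {K E F : Type*} [Field K] [Field E] [Field F] [Algebra K E] [Algebra K F]

/-- `Q` restricts to `P` along the embedding `φ`. -/
def Over (φ : E →ₐ[K] F) (Q : Place K F) (P : Place K E) : Prop :=
  Q.ring.comap (φ : E →+* F) = P.ring

/-- The restriction of a place along an embedding. -/
def comap (φ : E →ₐ[K] F) (Q : Place K F) (h : Q.ring.comap (φ : E →+* F) ≠ ⊤) : Place K E where
  ring := Q.ring.comap (φ : E →+* F)
  algebraMap_mem c := by
    rw [ValuationSubring.mem_comap]
    change φ (algebraMap K E c) ∈ Q.ring
    rw [φ.commutes]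
    exact Q.algebraMap_mem c
  ne_top := h

variable {φ : E →ₐ[K] F} {P P' : Place K E} {Q Q' : Place K F} {z w : E} {n : ℤ}

theorem Over.unique (h : Over φ Q P) (h' : Over φ Q P') : P = P' := ext (h.symm.trans h')

theorem Over.val_le_one (h : Over φ Q P) : Q.val (φ z) ≤ 1 ↔ P.val z ≤ 1 := by
  rw [← mem_ring_iff, ← mem_ring_iff, ← h]; rfl

theorem over_iff : Over φ Q P ↔ ∀ z, Q.val (φ z) ≤ 1 ↔ P.val z ≤ 1 :=
  ⟨fun h z => h.val_le_one, fun h => ValuationSubring.ext _ _ fun z => by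
    rw [mem_ring_iff, ← h, ← mem_ring_iff]; rfl⟩

theorem Over.one_lt_val (h : Over φ Q P) : 1 < Q.val (φ z) ↔ 1 < P.val z := by
  rw [← not_le, h.val_le_one, not_le]

theorem Over.val_lt_one (h : Over φ Q P) : Q.val (φ z) < 1 ↔ P.val z < 1 := by
  rcases eq_or_ne z 0 with rfl | hz
  · simp
  have := h.one_lt_val (z := z⁻¹)
  have hz' : φ z ≠ 0 := by simpa using hz
  rwa [map_inv₀, map_inv₀, map_inv₀, one_lt_inv₀ ((Valuation.pos_iff _).2 hz'),
    one_lt_inv₀ ((Valuation.pos_iff _).2 hz)] at this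

theorem Over.val_eq_one (h : Over φ Q P) : Q.val (φ z) = 1 ↔ P.val z = 1 := by
  simp only [le_antisymm_iff, h.val_le_one, ← not_lt, h.val_lt_one]

theorem Over.hasValue (h : Over φ Q P) (a : OnePoint K) : Q.HasValue (φ z) a ↔ P.HasValue z a := by
  induction a with
  | infty => rw [hasValue_infty, hasValue_infty, h.one_lt_val]
  | coe a => rw [hasValue_coe, hasValue_coe, ← φ.commutes, ← map_sub, h.val_lt_one]

theorem Over.val_map_eq_zpow (h : Over φ Q P) {t : E} (ht : P.IsUnif t) (hz : P.HasOrd z n) :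
    Q.val (φ z) = Q.val (φ t) ^ n := by
  have h1 : P.val (z / t ^ n) = 1 := by
    rw [map_div₀, map_zpow₀, ht.hasOrd_iff.1 hz, div_self (zpow_ne_zero _ ht.pos.ne')]
  rw [← h.val_eq_one, map_div₀, map_div₀, map_zpow₀, map_zpow₀] at h1
  exact eq_of_div_eq_one h1

/-- The valuation ring found by extension contains the image of `P.ring` and sends its maximal ideal
to nonunits. An element outside `P.ring` has its inverse in that maximal ideal, so the contraction
cannot be larger than `P.ring`. -/
theorem exists_over (φ : E →ₐ[K] F) (P : Place K E) : ∃ Q, Over φ Q P := by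
  obtain ⟨B, h1, h2⟩ := exists_valuationSubring ((φ : E →+* F).comp P.ring.subtype)
    (IsLocalRing.maximalIdeal P.ring) (Ideal.IsPrime.ne_top inferInstance) (by
      intro r hr
      have : (r : E) = 0 := by simpa [RingHom.mem_ker] using hr
      obtain rfl : r = 0 := Subtype.ext this
      exact zero_mem _)
  have h3 : ∀ z, P.val z < 1 → φ z ∈ B.nonunits := fun z hz =>
    h2 ⟨z, mem_ring_iff.2 hz.le⟩ ((P.ring.valuation_lt_one_iff _).2 hz)
  have h4 : ∀ z, 1 < P.val z → φ z ∉ B := by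
    intro z hz hB
    have := h3 z⁻¹ (by rw [map_inv₀]; exact inv_lt_one_of_one_lt₀ hz)
    rw [map_inv₀, ValuationSubring.inv_mem_nonunits_iff] at this
    rcases this with h | h
    · rw [map_eq_zero] at h
      rw [h, map_zero] at hz
      exact absurd hz (not_lt.2 zero_le)
    · exact h hB
  refine ⟨⟨B, fun c => ?_, ?_⟩, ValuationSubring.ext _ _ fun z => ⟨fun h => ?_, fun h => ?_⟩⟩
  · have := h1 ⟨_, P.algebraMap_mem c⟩
    simpa using this
  · rintro rfl
    obtain ⟨z, hz, hz1⟩ := P.exists_val_lt_one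
    refine h4 z⁻¹ ?_ trivial
    rw [map_inv₀]
    exact (one_lt_inv₀ ((Valuation.pos_iff _).2 hz)).2 hz1
  · rw [mem_ring_iff]
    by_contra! h'
    exact h4 z h' h
  · exact h1 ⟨z, h⟩

/-- The homomorphism of valuation rings at places lying over each other. -/
def Over.ringMap (h : Over φ Q P) : P.ring →+* Q.ring :=
  ((φ : E →+* F).comp P.ring.subtype).codRestrict Q.ring.toSubring fun z =>
    mem_ring_iff.2 (h.val_le_one.2 (mem_ring_iff.1 z.2))

theorem Over.isLocalHom (h : Over φ Q P) : IsLocalHom h.ringMap where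
  map_nonunit z hz := by
    rw [ValuationSubring.valuation_eq_one_iff] at hz ⊢
    exact h.val_eq_one.1 hz

/-- The embedding of residue class fields at places lying over each other. -/
noncomputable def Over.residueMap (h : Over φ Q P) :
    IsLocalRing.ResidueField P.ring →ₐ[K] IsLocalRing.ResidueField Q.ring :=
  { @IsLocalRing.ResidueField.map _ _ _ _ _ _ h.ringMap h.isLocalHom with
    commutes' := fun c => by
      change IsLocalRing.residue _ (h.ringMap (algebraMap K P.ring c)) =
        IsLocalRing.residue _ (algebraMap K Q.ring c)
      congr 1
      exact Subtype.ext (φ.commutes c) }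

theorem residue_eq_iff {z w : Q.ring} :
    IsLocalRing.residue _ z = IsLocalRing.residue _ w ↔ Q.val ((z : F) - w) < 1 := by
  rw [← sub_eq_zero, ← map_sub, IsLocalRing.residue_eq_zero_iff, Q.ring.valuation_lt_one_iff]
  rfl

theorem Over.degree_eq (h : Over φ Q P)
    (hs : ∀ z, Q.val z ≤ 1 → ∃ a, P.val a ≤ 1 ∧ Q.val (z - φ a) < 1) : Q.degree = P.degree := by
  have hb : Function.Bijective h.residueMap.toLinearMap := by
    refine ⟨h.residueMap.toRingHom.injective, fun z => ?_⟩
    obtain ⟨z, rfl⟩ := IsLocalRing.residue_surjective z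
    obtain ⟨a, ha, ha'⟩ := hs z (Q.ring.valuation_le_one z)
    refine ⟨IsLocalRing.residue _ ⟨a, mem_ring_iff.2 ha⟩, ?_⟩
    exact (residue_eq_iff.2 ha').symm
  exact (LinearEquiv.ofBijective _ hb).finrank_eq.symm

/-- Since `finrank` is zero in infinite dimension, no finiteness of `V` is needed; thus degrees can
be compared without first showing that residue fields are finite over `K`. -/
theorem finrank_prod_self (K V : Type*) [Field K] [AddCommGroup V] [Module K V] :
    Module.finrank K (V × V) = 2 * Module.finrank K V := by
  by_cases hV : Module.Finite K V
  · rw [Module.finrank_prod, two_mul]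
  · rw [Module.finrank_of_not_finite hV, Module.finrank_of_not_finite, mul_zero]
    intro h
    exact hV (Module.Finite.of_surjective (LinearMap.fst K V V) LinearMap.fst_surjective)

/-- The hypotheses say that 1 and the residue of `y` form a basis of the residue field of `Q` over
that of `P`. -/
theorem Over.degree_eq_two_mul (h : Over φ Q P) {y : F} (hy : Q.val y ≤ 1)
    (hs : ∀ z, Q.val z ≤ 1 → ∃ a b, P.val a ≤ 1 ∧ P.val b ≤ 1 ∧ z = φ a + φ b * y)
    (hi : ∀ a b, P.val a ≤ 1 → P.val b ≤ 1 → Q.val (φ a + φ b * y) < 1 →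
      P.val a < 1 ∧ P.val b < 1) : Q.degree = 2 * P.degree := by
  set Y := IsLocalRing.residue Q.ring ⟨y, mem_ring_iff.2 hy⟩
  let f : (IsLocalRing.ResidueField P.ring × IsLocalRing.ResidueField P.ring) →ₗ[K]
      IsLocalRing.ResidueField Q.ring :=
    h.residueMap.toLinearMap.coprod (LinearMap.mulRight K Y ∘ₗ h.residueMap.toLinearMap)
  have hf : ∀ a b : P.ring, f (IsLocalRing.residue _ a, IsLocalRing.residue _ b) =
      IsLocalRing.residue _ (h.ringMap a + h.ringMap b * ⟨y, mem_ring_iff.2 hy⟩) := by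
    intro a b
    rw [map_add, map_mul]
    rfl
  have hb : Function.Bijective f := by
    constructor
    · rw [← LinearMap.ker_eq_bot, LinearMap.ker_eq_bot']
      rintro ⟨a, b⟩ hab
      obtain ⟨a, rfl⟩ := IsLocalRing.residue_surjective a
      obtain ⟨b, rfl⟩ := IsLocalRing.residue_surjective b
      rw [hf, IsLocalRing.residue_eq_zero_iff, Q.ring.valuation_lt_one_iff] at hab
      obtain ⟨h1, h2⟩ := hi a b (P.ring.valuation_le_one a) (P.ring.valuation_le_one b) hab
      rw [Prod.mk_eq_zero, IsLocalRing.residue_eq_zero_iff, IsLocalRing.residue_eq_zero_iff,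
        P.ring.valuation_lt_one_iff, P.ring.valuation_lt_one_iff]
      exact ⟨h1, h2⟩
    · intro z
      obtain ⟨z, rfl⟩ := IsLocalRing.residue_surjective z
      obtain ⟨a, b, ha, hb, hz⟩ := hs z (Q.ring.valuation_le_one z)
      refine ⟨(IsLocalRing.residue _ ⟨a, mem_ring_iff.2 ha⟩,
        IsLocalRing.residue _ ⟨b, mem_ring_iff.2 hb⟩), ?_⟩
      rw [hf]
      congr 1
      exact Subtype.ext hz.symm
  rw [degree, ← (LinearEquiv.ofBijective f hb).finrank_eq, finrank_prod_self, degree]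

end Over

/-! ### Quadratic extensions and the places above a given place -/

/-- `F = E(y)` with `y ^ 2 = u ∈ E` and `y ∉ E`. -/
structure IsQuadratic {K E F : Type*} [Field K] [Field E] [Field F] [Algebra K E] [Algebra K F]
    (φ : E →ₐ[K] F) (y : F) (u : E) : Prop where
  sq : y ^ 2 = φ u
  span : ∀ z, ∃ a b, z = φ a + φ b * y
  ne : ∀ a, φ a ≠ y

variable {K E F : Type*} [Field K] [Field E] [Field F] [Algebra K E] [Algebra K F]
  {φ : E →ₐ[K] F} {y : F} {u : E} {P : Place K E} {Q Q' : Place K F} {k n : ℤ}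

namespace IsQuadratic

theorem eq_zero (hq : IsQuadratic φ y u) {a b : E} (h : φ a + φ b * y = 0) : a = 0 ∧ b = 0 := by
  have hb : b = 0 := by
    by_contra hb
    refine hq.ne (-a / b) ?_
    have : φ b ≠ 0 := by simpa using hb
    rw [map_div₀, map_neg]
    field_simp
    linear_combination -h
  subst hb
  simpa using h

theorem unique (hq : IsQuadratic φ y u) {a b a' b' : E}
    (h : φ a + φ b * y = φ a' + φ b' * y) : a = a' ∧ b = b' := by
  have := hq.eq_zero (a := a - a') (b := b - b') (by
    rw [map_sub, map_sub]; linear_combination h)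
  exact ⟨sub_eq_zero.1 this.1, sub_eq_zero.1 this.2⟩

theorem smul (hq : IsQuadratic φ y u) {c : E} (hc : c ≠ 0) :
    IsQuadratic φ (y / φ c) (u / c ^ 2) where
  sq := by rw [div_pow, hq.sq, map_div₀, map_pow]
  span z := by
    obtain ⟨a, b, rfl⟩ := hq.span z
    have : φ c ≠ 0 := by simpa using hc
    refine ⟨a, b * c, ?_⟩
    rw [map_mul]
    field_simp
  ne a h := by
    have : φ c ≠ 0 := by simpa using hc
    refine hq.ne (a * c) ?_
    rw [map_mul, h]
    field_simp

/-- The conjugation `a + b y ↦ a - b y`; uniqueness of the coordinates makes it independent of their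
choice and compatible with sums and products. -/
theorem exists_conj (hq : IsQuadratic φ y u) :
    ∃ σ : F →ₐ[K] F, (∀ a, σ (φ a) = φ a) ∧ σ y = -y := by
  choose f g hfg using hq.span
  let s : F → F := fun z => φ (f z) - φ (g z) * y
  have hs : ∀ a b, s (φ a + φ b * y) = φ a - φ b * y := by
    intro a b
    obtain ⟨h1, h2⟩ := hq.unique (hfg (φ a + φ b * y))
    simp only [s]
    rw [← h1, ← h2]
  have hs0 : ∀ a, s (φ a) = φ a := fun a => by simpa using hs a 0
  refine ⟨AlgHom.mk ⟨⟨⟨s, ?_⟩, ?_⟩, ?_, ?_⟩ ?_, hs0, ?_⟩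
  · simpa using hs0 1
  · intro z w
    obtain ⟨a, b, rfl⟩ := hq.span z
    obtain ⟨c, d, rfl⟩ := hq.span w
    have h1 : (φ a + φ b * y) * (φ c + φ d * y) = φ (a * c + b * d * u) + φ (a * d + b * c) * y := by
      simp only [map_add, map_mul, ← hq.sq]; ring
    rw [h1]
    change s _ = s _ * s _
    rw [hs, hs, hs]
    simp only [map_add, map_mul, ← hq.sq]; ring
  · simpa using hs0 0
  · intro z w
    obtain ⟨a, b, rfl⟩ := hq.span z
    obtain ⟨c, d, rfl⟩ := hq.span w
    have h1 : (φ a + φ b * y) + (φ c + φ d * y) = φ (a + c) + φ (b + d) * y := by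
      simp only [map_add]; ring
    rw [h1]
    change s _ = s _ + s _
    rw [hs, hs, hs]
    simp only [map_add]; ring
  · intro c
    have := hs0 (algebraMap K E c)
    rwa [φ.commutes] at this
  · simpa using hs 0 1

/-- The place conjugate to `Q`, which turns a place with `y = -c` into one with `y = c`. -/
theorem exists_conj_place (hq : IsQuadratic φ y u) (h : Over φ Q P) :
    ∃ Q', Over φ Q' P ∧ ∀ a, Q'.val (y - φ a) < 1 ↔ Q.val (y + φ a) < 1 := by
  obtain ⟨σ, hσ, hy⟩ := hq.exists_conj
  have hσσ : ∀ z, σ (σ z) = z := by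
    intro z
    obtain ⟨a, b, rfl⟩ := hq.span z
    simp [hσ, hy]
  have hne : Q.ring.comap (σ : F →+* F) ≠ ⊤ := by
    intro h0
    refine Q.ne_top (eq_top_iff.2 fun z _ => ?_)
    have h1 : σ z ∈ Q.ring.comap (σ : F →+* F) := h0 ▸ ValuationSubring.mem_top _
    have h2 : σ (σ z) ∈ Q.ring := h1
    rwa [hσσ] at h2
  have hover : Over σ Q (Q.comap σ hne) := rfl
  refine ⟨Q.comap σ hne, over_iff.2 fun z => ?_, fun a => ?_⟩
  · rw [← hover.val_le_one, hσ, h.val_le_one]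
  · rw [← hover.val_lt_one, map_sub, hσ, hy, ← Valuation.map_neg]
    congr! 2
    ring

/-! ### Odd order: the ramified case -/

/-- The squares of the two terms come from `a²` and `b² u` in `E`, whose orders have different
parity. Hence the terms have equal value only if both vanish, and the ultrametric inequality is an
equality. -/
theorem val_add (hq : IsQuadratic φ y u) (hP : P.IsDiscrete) (hu : P.HasOrd u (2 * k + 1))
    (h : Over φ Q P) (a b : E) :
    Q.val (φ a + φ b * y) = max (Q.val (φ a)) (Q.val (φ b * y)) := by
  by_cases hne : Q.val (φ a) = Q.val (φ b * y)
  · rcases eq_or_ne a 0 with rfl | ha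
    · rw [map_zero, map_zero] at hne
      rw [map_zero, zero_add, map_zero, ← hne, max_self]
    rcases eq_or_ne b 0 with rfl | hb
    · rw [map_zero, zero_mul, map_zero] at hne
      rw [map_zero, zero_mul, add_zero, map_zero, hne, max_self]
    obtain ⟨n, hn⟩ := hP a ha
    obtain ⟨m, hm⟩ := hP b hb
    have h1 := (hn.pow 2).div ((hm.pow 2).mul hu)
    have h2 : P.val (a ^ 2 / (b ^ 2 * u)) = 1 := by
      rw [← h.val_eq_one, map_div₀, map_mul, map_pow, map_pow, ← hq.sq, ← mul_pow, ← div_pow,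
        map_pow, map_div₀, hne, div_self, one_pow]
      rw [← hne]
      simpa using ha
    rw [h1.val_eq_one_iff] at h2
    push_cast at h2
    omega
  · exact Valuation.map_add_of_distinct_val _ hne

theorem val_mul_le_one (hq : IsQuadratic φ y u) (h : Over φ Q P) (b : E) :
    Q.val (φ b * y) ≤ 1 ↔ P.val (b ^ 2 * u) ≤ 1 := by
  rw [← h.val_le_one, map_mul φ, map_pow, ← hq.sq, ← mul_pow, map_pow]
  exact (pow_le_one_iff_of_nonneg zero_le two_ne_zero).symm

theorem over_unique_of_odd (hq : IsQuadratic φ y u) (hP : P.IsDiscrete)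
    (hu : P.HasOrd u (2 * k + 1)) (h : Over φ Q P) (h' : Over φ Q' P) : Q = Q' := by
  refine ext_val fun z => ?_
  obtain ⟨a, b, rfl⟩ := hq.span z
  rw [hq.val_add hP hu h, hq.val_add hP hu h', max_le_iff, max_le_iff, h.val_le_one,
    h'.val_le_one, hq.val_mul_le_one h, hq.val_mul_le_one h']

/-- By parity `φ b * y` never has value one, so an integral `a + b y` has the same residue as `a`:
the residue field does not grow. -/
theorem degree_of_odd (hq : IsQuadratic φ y u) (hP : P.IsDiscrete)
    (hu : P.HasOrd u (2 * k + 1)) (h : Over φ Q P) : Q.degree = P.degree := by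
  refine h.degree_eq fun z hz => ?_
  obtain ⟨a, b, rfl⟩ := hq.span z
  rw [hq.val_add hP hu h, max_le_iff, h.val_le_one] at hz
  refine ⟨a, hz.1, ?_⟩
  rw [add_sub_cancel_left]
  refine lt_of_le_of_ne hz.2 fun h1 => ?_
  have hb : b ≠ 0 := by rintro rfl; simp at h1
  obtain ⟨m, hm⟩ := hP b hb
  have h2 := (hm.pow 2).mul hu
  have h3 : P.val (b ^ 2 * u) = 1 := by
    rw [← h.val_eq_one, map_mul, map_pow, ← hq.sq, ← mul_pow, map_pow, h1, one_pow]
  rw [h2.val_eq_one_iff] at h3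
  push_cast at h3
  omega

theorem isDiscrete_of_odd (hq : IsQuadratic φ y u) (hP : P.IsDiscrete)
    (hu : P.HasOrd u (2 * k + 1)) (h : Over φ Q P) :
    Q.IsDiscrete ∧ Q.HasOrd y (2 * k + 1) ∧
      ∀ z n, P.HasOrd z n → Q.HasOrd (φ z) (2 * n) := by
  obtain ⟨t, ht⟩ := hP.exists_isUnif
  -- As `u` has order `2k + 1`, the square of `s` is `t` times a unit, so `s` is the prime element
  -- upstairs.
  set s := y / φ t ^ k with hs
  have ht0 : φ t ≠ 0 := by simpa using ht.ne_zero
  have ht0' : Q.val (φ t) ≠ 0 := by simpa using ht.ne_zero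
  have hsq : Q.val (φ t) = Q.val s ^ 2 := by
    have h1 : P.val (u / t ^ (2 * k + 1)) = 1 := by
      rw [map_div₀, map_zpow₀, ht.hasOrd_iff.1 hu, div_self (zpow_ne_zero _ ht.pos.ne')]
    rw [← h.val_eq_one, map_div₀, ← hq.sq, map_zpow₀] at h1
    have h2 : s ^ 2 = φ t * (y ^ 2 / φ t ^ (2 * k + 1)) := by
      rw [hs, div_pow, ← zpow_natCast (φ t ^ k), ← zpow_mul, zpow_add₀ ht0, zpow_one,
        mul_comm k]
      push_cast
      field_simp
    rw [← map_pow, h2, map_mul, h1, mul_one]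
  have hs1 : Q.val s < 1 := by
    have h1 := h.val_lt_one.2 ht.1
    rw [hsq, ← map_pow] at h1
    exact val_lt_one_of_pow h1
  have hs0 : Q.val s ≠ 0 := fun h0 => by rw [h0] at hsq; simp [ht0] at hsq
  have hzp : ∀ {z n}, P.HasOrd z n → Q.val (φ z) = Q.val s ^ (2 * n) := by
    intro z n hn
    rw [h.val_map_eq_zpow ht hn, hsq, zpow_mul]
    rfl
  have hy : Q.val y = Q.val s ^ (2 * k + 1) := by
    have : y = s * φ t ^ k := by rw [hs]; field_simp
    rw [this, map_mul, map_zpow₀, hsq, ← zpow_natCast, ← zpow_mul, zpow_add₀ hs0, zpow_one,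
      mul_comm]
    rfl
  have hall : ∀ z, z ≠ 0 → ∃ n : ℤ, Q.val z = Q.val s ^ n := by
    intro z hz
    obtain ⟨a, b, rfl⟩ := hq.span z
    have ha : a ≠ 0 → ∃ n : ℤ, Q.val (φ a) = Q.val s ^ n := fun ha =>
      let ⟨n, hn⟩ := hP a ha; ⟨_, hzp hn⟩
    have hb : b ≠ 0 → ∃ n : ℤ, Q.val (φ b * y) = Q.val s ^ n := fun hb => by
      obtain ⟨n, hn⟩ := hP b hb
      exact ⟨2 * n + (2 * k + 1), by rw [map_mul, hzp hn, hy, ← zpow_add₀ hs0]⟩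
    rcases eq_or_ne a 0 with rfl | ha0
    · rcases eq_or_ne b 0 with rfl | hb0
      · simp at hz
      · simpa using hb hb0
    rcases eq_or_ne b 0 with rfl | hb0
    · simpa using ha ha0
    rw [hq.val_add hP hu h]
    rcases max_choice (Q.val (φ a)) (Q.val (φ b * y)) with h1 | h1 <;> rw [h1]
    exacts [ha ha0, hb hb0]
  have hsu := isUnif_of_forall hs1 hall
  exact ⟨isDiscrete_of_forall hs1 hall, hsu.hasOrd_iff.2 hy, fun z n hn => hsu.hasOrd_iff.2 (hzp hn)⟩

/-! ### Even order: the unramified case -/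

/-- Factor out the coefficient of larger value. This reduces questions about `F` to integral
combinations with at least one unit coefficient. -/
theorem exists_primitive (hq : IsQuadratic φ y u) (P : Place K E) {z : F} (hz : z ≠ 0) :
    ∃ e a b, e ≠ 0 ∧ P.val a ≤ 1 ∧ P.val b ≤ 1 ∧ (P.val a = 1 ∨ P.val b = 1) ∧
      z = φ e * (φ a + φ b * y) := by
  obtain ⟨a, b, rfl⟩ := hq.span z
  rcases le_total (P.val b) (P.val a) with hab | hab
  · have ha : a ≠ 0 := by
      rintro rfl
      rw [map_zero, le_zero_iff, Valuation.zero_iff] at hab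
      simp [hab] at hz
    refine ⟨a, 1, b / a, ha, by simp, ?_, Or.inl (by simp), ?_⟩
    · rw [map_div₀]
      exact div_le_one_of_le₀ hab zero_le
    · have : φ a ≠ 0 := by simpa using ha
      rw [map_div₀, map_one]
      field_simp
  · have hb : b ≠ 0 := by
      rintro rfl
      rw [map_zero, le_zero_iff, Valuation.zero_iff] at hab
      simp [hab] at hz
    refine ⟨b, a / b, 1, hb, ?_, by simp, Or.inr (by simp), ?_⟩
    · rw [map_div₀]
      exact div_le_one_of_le₀ hab zero_le
    · have : φ b ≠ 0 := by simpa using hb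
      rw [map_div₀, map_one]
      field_simp

theorem val_eq_one (hq : IsQuadratic φ y u) (hu : P.val u = 1) (h : Over φ Q P) :
    Q.val y = 1 := by
  apply val_eq_one_of_sq
  rwa [hq.sq, h.val_eq_one]

theorem val_add_le (hq : IsQuadratic φ y u) (hu : P.val u = 1) (h : Over φ Q P) {a b : E}
    (ha : P.val a ≤ 1) (hb : P.val b ≤ 1) : Q.val (φ a + φ b * y) ≤ 1 := by
  refine Valuation.map_add_le _ (h.val_le_one.2 ha) ?_
  rw [map_mul, hq.val_eq_one hu h, mul_one]
  exact h.val_le_one.2 hb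

theorem norm_eq (hq : IsQuadratic φ y u) (a b : E) :
    (φ a + φ b * y) * (φ a + φ (-b) * y) = φ (a ^ 2 - b ^ 2 * u) := by
  simp only [map_sub, map_mul, map_pow, map_neg, ← hq.sq]; ring

/-- If a primitive element and its conjugate were both small, so would be their sum `2a` and
difference `2b y`, hence `a` and `b`, because 2 and `y` are units. -/
theorem val_conj_eq_one (hq : IsQuadratic φ y u) (h2 : (2 : K) ≠ 0) (hu : P.val u = 1)
    (h : Over φ Q P) {a b : E} (hab : P.val a = 1 ∨ P.val b = 1)
    (ha : P.val a ≤ 1) (hb : P.val b ≤ 1)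
    (hlt : Q.val (φ a + φ b * y) < 1) : Q.val (φ a + φ (-b) * y) = 1 := by
  by_contra hne
  have hlt' : Q.val (φ a + φ (-b) * y) < 1 :=
    lt_of_le_of_ne (hq.val_add_le hu h ha (by rwa [Valuation.map_neg])) hne
  have h2' : Q.val 2 = 1 := by
    have := Q.val_algebraMap h2
    rwa [map_ofNat] at this
  have h3 : Q.val (φ a) < 1 := by
    have := Q.val.map_add_lt hlt hlt'
    rwa [show φ a + φ b * y + (φ a + φ (-b) * y) = 2 * φ a by rw [map_neg]; ring, map_mul, h2',
      one_mul] at this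
  have h4 : Q.val (φ b) < 1 := by
    have := Q.val.map_sub_lt hlt hlt'
    rwa [show φ a + φ b * y - (φ a + φ (-b) * y) = 2 * φ b * y by rw [map_neg]; ring, map_mul,
      map_mul, h2', one_mul, hq.val_eq_one hu h, mul_one] at this
  rw [h.val_lt_one] at h3 h4
  rcases hab with h5 | h5
  exacts [h3.ne h5, h4.ne h5]

/-- The value group does not grow: a primitive element is either a unit or has the value of its
norm, its conjugate then being a unit. -/
theorem exists_val_eq (hq : IsQuadratic φ y u) (h2 : (2 : K) ≠ 0) (hu : P.val u = 1)
    (h : Over φ Q P) {z : F} (hz : z ≠ 0) : ∃ e, e ≠ 0 ∧ Q.val z = Q.val (φ e) := by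
  obtain ⟨e, a, b, he, ha, hb, hab, rfl⟩ := hq.exists_primitive P hz
  rcases (hq.val_add_le hu h ha hb).lt_or_eq with hlt | heq
  · have h1 := hq.val_conj_eq_one h2 hu h hab ha hb hlt
    refine ⟨e * (a ^ 2 - b ^ 2 * u), ?_, ?_⟩
    · refine mul_ne_zero he fun h0 => ?_
      have h3 := hq.norm_eq a b
      rw [h0, map_zero] at h3
      rcases mul_eq_zero.1 h3 with h4 | h4
      · rw [h4, mul_zero] at hz; exact hz rfl
      · rw [h4, map_zero] at h1; exact zero_ne_one h1
    · rw [map_mul, map_mul, map_mul, ← hq.norm_eq, map_mul, h1, mul_one]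
  · exact ⟨e, he, by rw [map_mul, heq, mul_one]⟩

theorem isDiscrete_of_unit (hq : IsQuadratic φ y u) (h2 : (2 : K) ≠ 0) (hu : P.val u = 1)
    (hP : P.IsDiscrete) (h : Over φ Q P) :
    Q.IsDiscrete ∧ ∀ z n, P.HasOrd z n → Q.HasOrd (φ z) n := by
  obtain ⟨t, ht⟩ := hP.exists_isUnif
  have h1 := h.val_lt_one.2 ht.1
  have hall : ∀ z, z ≠ 0 → ∃ n : ℤ, Q.val z = Q.val (φ t) ^ n := by
    intro z hz
    obtain ⟨e, he, h3⟩ := hq.exists_val_eq h2 hu h hz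
    obtain ⟨n, hn⟩ := hP e he
    exact ⟨n, h3.trans (h.val_map_eq_zpow ht hn)⟩
  exact ⟨isDiscrete_of_forall h1 hall,
    fun z n hn => (isUnif_of_forall h1 hall).hasOrd_iff.2 (h.val_map_eq_zpow ht hn)⟩

/-- A place above `P` is determined by the primitive elements that are small at it: the value of any
other primitive element is one, and that of a small one is the value of its norm, which lies in `E`.
-/
theorem eq_of_primitive (hq : IsQuadratic φ y u) (h2 : (2 : K) ≠ 0) (hu : P.val u = 1)
    (h : Over φ Q P) (h' : Over φ Q' P)
    (H : ∀ a b, P.val a ≤ 1 → P.val b ≤ 1 → (P.val a = 1 ∨ P.val b = 1) →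
      (Q.val (φ a + φ b * y) < 1 ↔ Q'.val (φ a + φ b * y) < 1)) : Q = Q' := by
  refine ext_val fun z => ?_
  rcases eq_or_ne z 0 with rfl | hz
  · simp
  obtain ⟨e, a, b, he, ha, hb, hab, rfl⟩ := hq.exists_primitive P hz
  rcases (hq.val_add_le hu h ha hb).lt_or_eq with hlt | heq
  · have h1 := hq.val_conj_eq_one h2 hu h hab ha hb hlt
    have h1' := hq.val_conj_eq_one h2 hu h' hab ha hb ((H a b ha hb hab).1 hlt)
    have h3 := congrArg Q.val (hq.norm_eq a b)
    have h3' := congrArg Q'.val (hq.norm_eq a b)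
    rw [map_mul, h1, mul_one] at h3
    rw [map_mul, h1', mul_one] at h3'
    rw [map_mul, map_mul, h3, h3', ← map_mul, ← map_mul, ← map_mul, ← map_mul, h.val_le_one,
      h'.val_le_one]
  · have heq' : Q'.val (φ a + φ b * y) = 1 :=
      le_antisymm (hq.val_add_le hu h' ha hb)
        (not_lt.1 fun h1 => ((H a b ha hb hab).2 h1).ne heq)
    rw [map_mul, map_mul, heq, heq', mul_one, mul_one, h.val_le_one, h'.val_le_one]

/-- Modulo the maximal ideal of `Q`, the element `y` may be replaced by `c`. -/
theorem val_add_lt_iff (h : Over φ Q P) {a b c : E}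
    (hb : P.val b ≤ 1) (hc : Q.val (y - φ c) < 1) :
    Q.val (φ a + φ b * y) < 1 ↔ P.val (a + b * c) < 1 := by
  rw [← h.val_lt_one]
  have h1 : Q.val (φ b * (y - φ c)) < 1 := by
    rw [map_mul]
    exact mul_lt_one_of_nonneg_of_lt_one_right (h.val_le_one.2 hb) zero_le hc
  have h2 : φ a + φ b * y = φ (a + b * c) + φ b * (y - φ c) := by
    rw [map_add, map_mul]; ring
  constructor
  · intro h3
    have := Q.val.map_sub_lt h3 h1
    rwa [h2, add_sub_cancel_right] at this
  · intro h3
    rw [h2]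
    exact Q.val.map_add_lt h3 h1

theorem eq_of_split (hq : IsQuadratic φ y u) (h2 : (2 : K) ≠ 0) (hu : P.val u = 1)
    (h : Over φ Q P) (h' : Over φ Q' P) {c : E} (hc : Q.val (y - φ c) < 1)
    (hc' : Q'.val (y - φ c) < 1) : Q = Q' :=
  hq.eq_of_primitive h2 hu h h' fun a b _ hb _ => by
    rw [val_add_lt_iff h hb hc, val_add_lt_iff h' hb hc']

theorem val_sub_or (hq : IsQuadratic φ y u) (h : Over φ Q P) {c : E}
    (hc : P.val (u - c ^ 2) < 1) : Q.val (y - φ c) < 1 ∨ Q.val (y + φ c) < 1 := by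
  by_contra! h1
  rw [← h.val_lt_one, map_sub, map_pow, ← hq.sq,
    show y ^ 2 - φ c ^ 2 = (y - φ c) * (y + φ c) by ring, map_mul] at hc
  exact absurd hc (not_lt.2 (one_le_mul h1.1 h1.2))

theorem exists_split (hq : IsQuadratic φ y u) {c : E} (hc : P.val (u - c ^ 2) < 1) :
    ∃ Q, Over φ Q P ∧ Q.val (y - φ c) < 1 := by
  obtain ⟨Q, h⟩ := exists_over φ P
  rcases hq.val_sub_or h hc with h1 | h1
  · exact ⟨Q, h, h1⟩
  · obtain ⟨Q', h', h2⟩ := hq.exists_conj_place h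
    exact ⟨Q', h', (h2 c).2 h1⟩

theorem val_eq_one_of_split (hu : P.val u = 1) {c : E} (hc : P.val (u - c ^ 2) < 1) :
    P.val c = 1 := val_eq_one_of_sq (val_eq_one_of_sub hu hc)

theorem val_two_mul (h2 : (2 : K) ≠ 0) (z : F) : Q.val (2 * z) = Q.val z := by
  have := Q.val_algebraMap h2
  rw [map_ofNat] at this
  rw [map_mul, this, one_mul]

theorem val_add_eq_one (h2 : (2 : K) ≠ 0) (h : Over φ Q P) {c : E} (hc1 : P.val c = 1)
    (hc : Q.val (y - φ c) < 1) : Q.val (y + φ c) = 1 := by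
  have h3 : Q.val (2 * φ c) = 1 := by rw [val_two_mul h2, h.val_eq_one, hc1]
  rw [← h3] at hc
  have h4 := Valuation.map_add_eq_of_lt_left _ hc
  rw [← h3, ← h4]
  congr 1
  ring

theorem degree_of_split (hq : IsQuadratic φ y u) (h2 : (2 : K) ≠ 0) (hu : P.val u = 1)
    (h : Over φ Q P) {c : E} (hc1 : P.val c = 1) (hc : Q.val (y - φ c) < 1) :
    Q.degree = P.degree := by
  have hred : ∀ a b, P.val b ≤ 1 → Q.val (φ a + φ b * y - φ (a + b * c)) < 1 := by
    intro a b hb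
    have := (val_add_lt_iff (a := -(b * c)) h hb hc).2 (by simp)
    convert this using 2
    simp only [map_add, map_mul, map_neg]; ring
  refine h.degree_eq fun z hz => ?_
  rcases hz.lt_or_eq with hz1 | hz1
  · exact ⟨0, by simp, by simpa using hz1⟩
  have hz0 : z ≠ 0 := by rintro rfl; simp at hz1
  obtain ⟨e, a, b, he, ha, hb, hab, rfl⟩ := hq.exists_primitive P hz0
  have hbc : ∀ {a b}, P.val a ≤ 1 → P.val b ≤ 1 → P.val (a + b * c) ≤ 1 := by
    intro a b ha hb
    refine Valuation.map_add_le _ ha ?_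
    rwa [map_mul, hc1, mul_one]
  rcases (hq.val_add_le hu h ha hb).lt_or_eq with hlt | heq
  · have h1 := hq.val_conj_eq_one h2 hu h hab ha hb hlt
    have hb' : P.val (-b) ≤ 1 := by rwa [Valuation.map_neg]
    set w := φ a + φ (-b) * y with hw
    set d := a + -b * c with hd
    have h4 : Q.val (w - φ d) < 1 := hred a (-b) hb'
    have h5 : Q.val (φ d) = 1 := val_eq_one_of_sub h1 h4
    have h6 : φ d ≠ 0 := by intro h0; rw [h0] at h5; simp at h5
    have h7 : φ (a ^ 2 - b ^ 2 * u) = (φ a + φ b * y) * w := (hq.norm_eq a b).symm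
    -- The element is its norm times `e`, divided by the conjugate `w`; as `w` is congruent to the
    -- unit `d` of `E`, replacing `w` by `d` does not change the residue.
    refine ⟨e * (a ^ 2 - b ^ 2 * u) / d, ?_, ?_⟩
    · rw [← h.val_le_one, map_div₀, map_mul, h7, ← mul_assoc, map_div₀, map_mul, hz1, h1, h5]
      simp
    · rw [map_div₀, map_mul, h7, show φ e * (φ a + φ b * y) - φ e * ((φ a + φ b * y) * w) / φ d =
        -(φ e * (φ a + φ b * y) * (w - φ d) / φ d) by field_simp; ring, Valuation.map_neg, map_div₀,
        map_mul, hz1, h5]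
      simpa using h4
  · have h1 : Q.val (φ e) = 1 := by rwa [map_mul, heq, mul_one] at hz1
    refine ⟨e * (a + b * c), ?_, ?_⟩
    · rw [map_mul, h.val_eq_one.1 h1, one_mul]
      exact hbc ha hb
    · rw [map_mul, ← mul_sub, map_mul, h1, one_mul]
      exact hred a b hb

/-- In `u - c² = (y - c)(y + c)` the second factor is a unit, being congruent to `2c`. -/
theorem hasOrd_sub (hq : IsQuadratic φ y u) (h2 : (2 : K) ≠ 0) (hu : P.val u = 1)
    (hP : P.IsDiscrete) (h : Over φ Q P) {c : E} (hc1 : P.val c = 1) (hc : Q.val (y - φ c) < 1)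
    (hn : P.HasOrd (u - c ^ 2) n) : Q.HasOrd (y - φ c) n := by
  refine ((hq.isDiscrete_of_unit h2 hu hP h).2 _ _ hn).of_val_eq ?_
  rw [map_sub φ, map_pow, ← hq.sq, show y ^ 2 - φ c ^ 2 = (y - φ c) * (y + φ c) by ring, map_mul,
    val_add_eq_one h2 h hc1 hc, mul_one]

/-- If `a + b y` is small, so is its norm `a² - b² u`; were `b` a unit, `u` would be congruent to
the square of `a / b`. -/
theorem val_primitive_of_inert (hq : IsQuadratic φ y u) (h : Over φ Q P)
    (hc : ∀ c, ¬ P.val (u - c ^ 2) < 1) {a b : E} (ha : P.val a ≤ 1) (hb : P.val b ≤ 1)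
    (hu : P.val u = 1)
    (hlt : Q.val (φ a + φ b * y) < 1) : P.val a < 1 ∧ P.val b < 1 := by
  have h1 : P.val (a ^ 2 - b ^ 2 * u) < 1 := by
    rw [← h.val_lt_one, ← hq.norm_eq, map_mul]
    exact mul_lt_one_of_lt_of_le hlt (hq.val_add_le hu h ha (by rwa [Valuation.map_neg]))
  have h2 : P.val b < 1 := by
    refine lt_of_le_of_ne hb fun hb1 => hc (a / b) ?_
    have hb0 : b ≠ 0 := by rintro rfl; simp at hb1
    rw [show u - (a / b) ^ 2 = -((a ^ 2 - b ^ 2 * u) / b ^ 2) by field_simp; ring,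
      Valuation.map_neg, map_div₀, map_pow _ b, hb1]
    simpa using h1
  refine ⟨val_lt_one_of_pow (k := 2) ?_, h2⟩
  have h3 : P.val (b ^ 2 * u) < 1 := by
    rw [map_mul, hu, mul_one, map_pow]
    exact pow_lt_one₀ zero_le h2 two_ne_zero
  have := P.val.map_add_lt h1 h3
  rwa [sub_add_cancel] at this

/-- The places over `P` and the sum of their degrees. -/
theorem fiber_of_unit (hq : IsQuadratic φ y u) (h2 : (2 : K) ≠ 0) (hu : P.val u = 1) :
    {Q | Over φ Q P}.Finite ∧ ∑ᶠ Q ∈ {Q | Over φ Q P}, Q.degree = 2 * P.degree := by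
  -- If `u` is a square in the residue field, the places `y = c` and `y = -c` each keep the degree
  -- of `P`; otherwise there is one place and its residue field is quadratic over that of `P`.
  by_cases hs : ∃ c, P.val (u - c ^ 2) < 1
  · obtain ⟨c, hc⟩ := hs
    have hc1 := val_eq_one_of_split hu hc
    obtain ⟨Q, h, hQ⟩ := hq.exists_split hc
    obtain ⟨Q', h', hQ'⟩ := hq.exists_split (c := -c) (by rwa [neg_sq])
    have hne : Q ≠ Q' := by
      rintro rfl
      have := val_add_eq_one h2 h hc1 hQ
      rw [map_neg, sub_neg_eq_add] at hQ'
      exact hQ'.ne this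
    have hset : {Q | Over φ Q P} = {Q, Q'} := by
      refine Set.ext fun R => ⟨fun hR => ?_, ?_⟩
      · rcases hq.val_sub_or hR hc with h1 | h1
        · exact Or.inl (hq.eq_of_split h2 hu hR h h1 hQ)
        · refine Or.inr (hq.eq_of_split h2 hu hR h' (c := -c) ?_ hQ')
          rwa [map_neg, sub_neg_eq_add]
      · rintro (rfl | rfl)
        exacts [h, h']
    rw [hset]
    refine ⟨Set.toFinite _, ?_⟩
    rw [finsum_mem_pair hne, hq.degree_of_split h2 hu h hc1 hQ,
      hq.degree_of_split h2 hu h' (by rwa [Valuation.map_neg]) hQ', two_mul]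
  · push Not at hs
    have hs' : ∀ c, ¬ P.val (u - c ^ 2) < 1 := fun c => not_lt.2 (hs c)
    obtain ⟨Q, h⟩ := exists_over φ P
    have hprim : ∀ {R}, Over φ R P → ∀ a b, P.val a ≤ 1 → P.val b ≤ 1 →
        (P.val a = 1 ∨ P.val b = 1) → ¬ R.val (φ a + φ b * y) < 1 := by
      intro R hR a b ha hb hab hlt
      obtain ⟨h3, h4⟩ := hq.val_primitive_of_inert hR hs' ha hb hu hlt
      rcases hab with h5 | h5
      exacts [h3.ne h5, h4.ne h5]
    have hset : {Q | Over φ Q P} = {Q} := by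
      refine Set.ext fun R => ⟨fun hR => ?_, ?_⟩
      · exact hq.eq_of_primitive h2 hu hR h fun a b ha hb hab => by
          simp only [hprim hR a b ha hb hab, hprim h a b ha hb hab]
      · rintro rfl; exact h
    rw [hset]
    refine ⟨Set.toFinite _, ?_⟩
    rw [finsum_mem_singleton]
    refine h.degree_eq_two_mul (hq.val_eq_one hu h).le (fun z hz => ?_) fun a b ha hb hlt =>
      hq.val_primitive_of_inert h hs' ha hb hu hlt
    rcases eq_or_ne z 0 with rfl | hz0
    · exact ⟨0, 0, by simp⟩
    obtain ⟨e, a, b, he, ha, hb, hab, rfl⟩ := hq.exists_primitive P hz0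
    have h1 : Q.val (φ a + φ b * y) = 1 :=
      le_antisymm (hq.val_add_le hu h ha hb) (not_lt.1 (hprim h a b ha hb hab))
    rw [map_mul, h1, mul_one, h.val_le_one] at hz
    refine ⟨e * a, e * b, ?_, ?_, ?_⟩
    · rw [map_mul]; exact mul_le_one₀ hz zero_le ha
    · rw [map_mul]; exact mul_le_one₀ hz zero_le hb
    · rw [map_mul, map_mul]; ring

/-- Reduction to a unit `u` by dividing `y` by `t ^ k`. The order of the divisor `c` is recorded
because it becomes the order of `y`. -/
theorem exists_unit_of_even (hq : IsQuadratic φ y u) (hu : P.HasOrd u (2 * k)) :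
    ∃ c, P.HasOrd c k ∧ IsQuadratic φ (y / φ c) (u / c ^ 2) ∧ P.val (u / c ^ 2) = 1 := by
  obtain ⟨t, ht⟩ := hu.exists_isUnif
  have hc : P.HasOrd (t ^ k) k := ht.hasOrd_iff.2 (map_zpow₀ _ _ _)
  refine ⟨t ^ k, hc, hq.smul hc.ne_zero, ?_⟩
  have := hu.div (hc.pow 2)
  rw [this.val_eq_one_iff]
  simp

theorem isDiscrete_of_even (hq : IsQuadratic φ y u) (h2 : (2 : K) ≠ 0) (hP : P.IsDiscrete)
    (hu : P.HasOrd u (2 * k)) (h : Over φ Q P) :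
    Q.IsDiscrete ∧ Q.HasOrd y k ∧ ∀ z n, P.HasOrd z n → Q.HasOrd (φ z) n := by
  obtain ⟨c, hc, hq', hu'⟩ := hq.exists_unit_of_even hu
  obtain ⟨h3, h4⟩ := hq'.isDiscrete_of_unit h2 hu' hP h
  refine ⟨h3, ?_, h4⟩
  have h5 := (h3.hasOrd_zero (hq'.val_eq_one hu' h)).mul (h4 c k hc)
  rwa [zero_add, div_mul_cancel₀ _ (by simpa using hc.ne_zero)] at h5

theorem fiber_of_even (hq : IsQuadratic φ y u) (h2 : (2 : K) ≠ 0) (hu : P.HasOrd u (2 * k)) :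
    {Q | Over φ Q P}.Finite ∧ ∑ᶠ Q ∈ {Q | Over φ Q P}, Q.degree = 2 * P.degree := by
  obtain ⟨c, hc, hq', hu'⟩ := hq.exists_unit_of_even hu
  exact hq'.fiber_of_unit h2 hu'

/-- The factor 1 gives this the same shape as `fiber_of_even`, as needed for summing over fibres
with a common multiplier. -/
theorem fiber_of_odd (hq : IsQuadratic φ y u) (hP : P.IsDiscrete)
    (hu : P.HasOrd u (2 * k + 1)) :
    {Q | Over φ Q P}.Finite ∧ ∑ᶠ Q ∈ {Q | Over φ Q P}, Q.degree = 1 * P.degree := by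
  obtain ⟨Q, h⟩ := exists_over φ P
  have hset : {Q | Over φ Q P} = {Q} :=
    Set.ext fun R => ⟨fun hR => hq.over_unique_of_odd hP hu hR h, by rintro rfl; exact h⟩
  rw [hset, finsum_mem_singleton, hq.degree_of_odd hP hu h, one_mul]
  exact ⟨Set.toFinite _, rfl⟩

theorem isDiscrete (hq : IsQuadratic φ y u) (h2 : (2 : K) ≠ 0) (hP : P.IsDiscrete)
    (h : Over φ Q P) : Q.IsDiscrete := by
  have hu : u ≠ 0 := by
    rintro rfl
    refine hq.ne 0 ?_
    have := hq.sq
    rw [map_zero] at this ⊢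
    exact (pow_eq_zero_iff two_ne_zero |>.1 this).symm
  obtain ⟨n, hn⟩ := hP u hu
  obtain ⟨k, rfl | rfl⟩ := n.even_or_odd'
  · exact (hq.isDiscrete_of_even h2 hP hn h).1
  · exact (hq.isDiscrete_of_odd hP hn h).1

/-- A valuation ring of `F` containing `E` contains `y`, since it contains `y² = u`; it would be all
of `F`. Hence places restrict to places. -/
theorem comap_ne_top (hq : IsQuadratic φ y u) (Q : Place K F) :
    Q.ring.comap (φ : E →+* F) ≠ ⊤ := by
  intro h0
  have h1 : ∀ z, φ z ∈ Q.ring := fun z =>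
    ValuationSubring.mem_comap.1 (h0 ▸ ValuationSubring.mem_top z)
  refine Q.ne_top (eq_top_iff.2 fun z _ => ?_)
  obtain ⟨a, b, rfl⟩ := hq.span z
  refine add_mem (h1 a) (mul_mem (h1 b) ?_)
  have h2 := h1 u
  rw [← hq.sq, mem_ring_iff, map_pow] at h2
  rw [mem_ring_iff]
  exact (pow_le_one_iff_of_nonneg zero_le two_ne_zero).1 h2

end IsQuadratic

/-! ### Places of the rational function field -/

open Polynomial

section Rational

variable {K F : Type*} [Field K] [Field F] [Algebra K F] {P Q : Place K F} {w : F} {a : K}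

theorem val_aeval_le (hw : P.val w ≤ 1) (f : K[X]) : P.val (aeval w f) ≤ 1 := by
  induction f using Polynomial.induction_on' with
  | add f g hf hg => rw [map_add]; exact Valuation.map_add_le _ hf hg
  | monomial n c =>
    rw [aeval_monomial, map_mul, map_pow]
    exact mul_le_one₀ (P.val_algebraMap_le c) zero_le (pow_le_one₀ zero_le hw)

/-- The polynomials in `w` of value below one form an ideal, which is principal. Splitting off
powers of its generator `π` leaves elements of value one, so all nonzero values are powers of that
of `π`. -/
theorem isDiscrete_of_rational (hgen : ∀ z : F, ∃ f g : K[X], z = aeval w f / aeval w g)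
    (hw : P.val w ≤ 1) : P.IsDiscrete := by
  let I : Ideal K[X] :=
    { carrier := {f | P.val (aeval w f) < 1}
      add_mem' := fun {f g} hf hg => by
        simp only [Set.mem_ofPred_eq, map_add]
        exact P.val.map_add_lt hf hg
      zero_mem' := by simp
      smul_mem' := fun c f hf => by
        simp only [Set.mem_ofPred_eq, smul_eq_mul, map_mul]
        exact mul_lt_one_of_nonneg_of_lt_one_right (val_aeval_le hw c) zero_le hf }
  have hI : ∀ f, f ∈ I ↔ P.val (aeval w f) < 1 := fun f => Iff.rfl
  obtain ⟨π, hπ⟩ := (IsPrincipalIdealRing.principal I).principal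
  have hπI : ∀ f : K[X], π ∣ f ↔ P.val (aeval w f) < 1 := by
    intro f
    rw [← hI, hπ]
    exact (Ideal.mem_span_singleton).symm
  have ht : P.val (aeval w π) < 1 := (hπI π).1 dvd_rfl
  have hpol : ∀ f : K[X], aeval w f ≠ 0 → ∃ n : ℕ, P.val (aeval w f) = P.val (aeval w π) ^ n := by
    intro f hf
    have hf0 : f ≠ 0 := by rintro rfl; simp at hf
    have hunit : ¬ IsUnit π := by
      intro h
      have h1 := (hπI 1).1 h.dvd
      simp at h1
    obtain ⟨g, hfg, hg⟩ :=
      (FiniteMultiplicity.of_not_isUnit hunit hf0).exists_eq_pow_mul_and_not_dvd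
    refine ⟨multiplicity π f, ?_⟩
    have h1 : P.val (aeval w g) = 1 :=
      le_antisymm (val_aeval_le hw g) (not_lt.1 fun h => hg ((hπI g).2 h))
    conv_lhs => rw [hfg, map_mul, map_mul, h1, mul_one, map_pow, map_pow]
  have ht0 : P.val (aeval w π) ≠ 0 := by
    intro h0
    have hone : ∀ f : K[X], aeval w f ≠ 0 → P.val (aeval w f) = 1 := by
      intro f hf
      obtain ⟨n, hn⟩ := hpol f hf
      rcases n with _ | n
      · simpa using hn
      · rw [h0, zero_pow n.succ_ne_zero, Valuation.zero_iff] at hn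
        exact absurd hn hf
    obtain ⟨z, hz, hz1⟩ := P.exists_val_lt_one
    obtain ⟨f, g, rfl⟩ := hgen z
    rw [div_ne_zero_iff] at hz
    rw [map_div₀, hone f hz.1, hone g hz.2] at hz1
    simp at hz1
  refine isDiscrete_of_forall ht fun z hz => ?_
  obtain ⟨f, g, rfl⟩ := hgen z
  rw [div_ne_zero_iff] at hz
  obtain ⟨n, hn⟩ := hpol f hz.1
  obtain ⟨m, hm⟩ := hpol g hz.2
  exact ⟨(n : ℤ) - m, by rw [map_div₀, hn, hm, zpow_sub₀ ht0, zpow_natCast, zpow_natCast]⟩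

theorem val_sub_div_lt {z z' : F} {c c' : K} (hc : c ≠ 0) (hc' : c' ≠ 0)
    (hz : P.val (z - algebraMap K F c) < 1) (hz' : P.val (z' - algebraMap K F c') < 1) :
    P.val (z / z' - algebraMap K F (c / c')) < 1 := by
  have h1 := P.val_algebraMap hc
  have h1' := P.val_algebraMap hc'
  have h2 : P.val z' = 1 := by
    apply val_eq_one_of_sub h1'
    rwa [Valuation.map_sub_swap]
  have h3 : algebraMap K F c' ≠ 0 := by simpa using hc'
  have h4 : z' ≠ 0 := by rintro rfl; simp at h2
  rw [map_div₀, show z / z' - algebraMap K F c / algebraMap K F c' =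
    ((z - algebraMap K F c) * algebraMap K F c' - algebraMap K F c * (z' - algebraMap K F c')) /
      (z' * algebraMap K F c') by field_simp; ring, map_div₀, map_mul, h1', h2, one_mul, div_one]
  refine P.val.map_sub_lt ?_ ?_
  · rwa [map_mul, h1', mul_one]
  · rwa [map_mul, h1, one_mul]

/-- The order and the leading coefficient of `z` at `w = a`. Both are chosen before the place `P`,
so all places with `w = a` assign the same orders; uniqueness of the place rests on this. -/
theorem exists_leading (hgen : ∀ z : F, ∃ f g : K[X], z = aeval w f / aeval w g)
    (a : K) {z : F} (hz : z ≠ 0) : ∃ (n : ℤ) (c : K), c ≠ 0 ∧ ∀ P : Place K F,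
      P.val (w - algebraMap K F a) < 1 → w - algebraMap K F a ≠ 0 →
        P.val (z / (w - algebraMap K F a) ^ n - algebraMap K F c) < 1 := by
  have hpol : ∀ f : K[X], f ≠ 0 → ∃ (n : ℕ) (c : K), c ≠ 0 ∧ ∀ P : Place K F,
      P.val (w - algebraMap K F a) < 1 → w - algebraMap K F a ≠ 0 →
        P.val (aeval w f / (w - algebraMap K F a) ^ n - algebraMap K F c) < 1 := by
    intro f hf
    have hunit : ¬ IsUnit (X - C a) := not_isUnit_X_sub_C a
    obtain ⟨g, hfg, hg⟩ :=
      (FiniteMultiplicity.of_not_isUnit hunit hf).exists_eq_pow_mul_and_not_dvd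
    refine ⟨multiplicity (X - C a) f, g.eval a, fun h0 => hg (dvd_iff_isRoot.2 h0), ?_⟩
    intro P hP hne
    have hw : P.val w ≤ 1 := by
      have := Valuation.map_add_le _ hP.le (P.val_algebraMap_le a)
      rwa [sub_add_cancel] at this
    have h1 : aeval w f = (w - algebraMap K F a) ^ multiplicity (X - C a) f * aeval w g := by
      conv_lhs => rw [hfg]
      simp
    rw [h1, mul_div_cancel_left₀ _ (pow_ne_zero _ hne)]
    obtain ⟨q, hq⟩ : X - C a ∣ g - C (g.eval a) := by
      rw [dvd_iff_isRoot]; simp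
    have h2 : aeval w g - algebraMap K F (g.eval a) =
        (w - algebraMap K F a) * aeval w q := by
      have := congrArg (aeval w) hq
      simpa using this
    rw [h2, map_mul]
    exact mul_lt_one_of_nonneg_of_lt_one_left zero_le hP (val_aeval_le hw q)
  obtain ⟨f, g, rfl⟩ := hgen z
  have hf : f ≠ 0 := by rintro rfl; simp at hz
  have hg : g ≠ 0 := by rintro rfl; simp at hz
  obtain ⟨n, c, hc, h⟩ := hpol f hf
  obtain ⟨m, d, hd, h'⟩ := hpol g hg
  refine ⟨(n : ℤ) - m, c / d, div_ne_zero hc hd, fun P hP hne => ?_⟩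
  have := val_sub_div_lt hc hd (h P hP hne) (h' P hP hne)
  rwa [div_div_div_comm, ← zpow_natCast, ← zpow_natCast, ← zpow_sub₀ hne] at this

theorem exists_unique_of_rational (hgen : ∀ z : F, ∃ f g : K[X], z = aeval w f / aeval w g)
    (hw : Transcendental K w) (a : K) : ∃ P : Place K F,
      (∀ S : Place K F, S.val (w - algebraMap K F a) < 1 ↔ S = P) ∧ P.degree = 1 ∧
        P.HasOrd (w - algebraMap K F a) 1 := by
  have hne : w - algebraMap K F a ≠ 0 := by
    intro h
    refine hw ?_
    rw [sub_eq_zero.1 h]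
    exact isAlgebraic_algebraMap a
  have hval : ∀ z : F, z ≠ 0 → ∃ (n : ℤ) (c : K), ∀ P : Place K F,
      P.val (w - algebraMap K F a) < 1 → P.val z = P.val (w - algebraMap K F a) ^ n ∧
        P.val (z / (w - algebraMap K F a) ^ n - algebraMap K F c) < 1 := by
    intro z hz
    obtain ⟨n, c, hc, h⟩ := exists_leading hgen a hz
    refine ⟨n, c, fun P hP => ⟨?_, h P hP hne⟩⟩
    have h1 := h P hP hne
    rw [Valuation.map_sub_swap] at h1
    have h2 := val_eq_one_of_sub (P.val_algebraMap hc) h1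
    rw [map_div₀, map_zpow₀] at h2
    exact eq_of_div_eq_one h2
  -- Existence comes from the ideal `(X - a)` of `K[X]`; transcendence of `w` makes evaluation
  -- injective, so the kernel condition holds.
  obtain ⟨B, h1, h2⟩ := exists_valuationSubring (aeval w : K[X] →ₐ[K] F).toRingHom
    (Ideal.span {X - C a}) (by
      rw [Ne, Ideal.span_singleton_eq_top]; exact not_isUnit_X_sub_C a) (by
      intro f hf
      have : f = 0 := by
        by_contra hf0
        exact hw ⟨f, hf0, by simpa [RingHom.mem_ker] using hf⟩
      rw [this]; exact zero_mem _)
  have h3 : w - algebraMap K F a ∈ B.nonunits := by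
    have := h2 (X - C a) (Ideal.mem_span_singleton_self _)
    simpa using this
  let P : Place K F := ⟨B, fun c => by simpa using h1 (C c), by
    rintro rfl
    rw [ValuationSubring.mem_nonunits_iff_or] at h3
    exact h3.elim hne fun h => h trivial⟩
  have hP : P.val (w - algebraMap K F a) < 1 := mem_nonunits_iff.1 h3
  have hall : ∀ z, z ≠ 0 → ∃ n : ℤ, P.val z = P.val (w - algebraMap K F a) ^ n := fun z hz =>
    let ⟨n, _, h⟩ := hval z hz; ⟨n, (h P hP).1⟩
  have hunif := isUnif_of_forall hP hall
  refine ⟨P, fun S => ⟨fun hS => ext_val fun z => ?_, by rintro rfl; exact hP⟩,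
    degree_eq_one fun z hz => ?_, hunif.hasOrd_one⟩
  · rcases eq_or_ne z 0 with rfl | hz
    · simp
    obtain ⟨n, c, h⟩ := hval z hz
    have hw0 : ∀ S : Place K F, 0 < S.val (w - algebraMap K F a) := fun S =>
      (Valuation.pos_iff _).2 hne
    rw [(h S hS).1, (h P hP).1, ← zpow_zero (S.val (w - algebraMap K F a)),
      ← zpow_zero (P.val (w - algebraMap K F a)),
      zpow_le_zpow_iff_right_of_lt_one₀ (hw0 S) hS, zpow_le_zpow_iff_right_of_lt_one₀ (hw0 P) hP]
  · rcases hz.lt_or_eq with hz1 | hz1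
    · exact ⟨0, by simpa using hz1⟩
    have hz0 : z ≠ 0 := by rintro rfl; simp at hz1
    obtain ⟨n, c, h⟩ := hval z hz0
    obtain ⟨h4, h5⟩ := h P hP
    have hn : n = 0 := (hunif.hasOrd_iff.2 h4).val_eq_one_iff.1 hz1
    rw [hn, zpow_zero, div_one] at h5
    exact ⟨c, h5⟩

/-- The local parameter of the rational function field `K(x)` where `x` takes the value `a`. -/
noncomputable def localParam (w : F) : OnePoint K → F
  | ∞ => w⁻¹
  | (a : K) => w - algebraMap K F a

/-- The value `∞` of `w` is the value 0 of `w⁻¹`, whence the second generation hypothesis. -/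
theorem exists_unique_hasValue (hgen : ∀ z : F, ∃ f g : K[X], z = aeval w f / aeval w g)
    (hgen' : ∀ z : F, ∃ f g : K[X], z = aeval w⁻¹ f / aeval w⁻¹ g)
    (hw : Transcendental K w) (a : OnePoint K) : ∃ P : Place K F,
      (∀ S : Place K F, S.HasValue w a ↔ S = P) ∧ P.degree = 1 ∧
        P.HasOrd (localParam w a) 1 := by
  induction a with
  | coe a =>
    simp only [hasValue_coe]
    exact exists_unique_of_rational hgen hw a
  | infty =>
    have hw' : Transcendental K w⁻¹ := fun h => hw (by simpa using h.inv)
    have hw0 : w ≠ 0 := by rintro rfl; exact hw (isAlgebraic_zero)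
    obtain ⟨P, h1, h2, h3⟩ := exists_unique_of_rational hgen' hw' 0
    rw [map_zero, sub_zero] at h3
    refine ⟨P, fun S => ?_, h2, h3⟩
    rw [← h1, map_zero, sub_zero, hasValue_infty, map_inv₀]
    exact (inv_lt_one₀ ((Valuation.pos_iff _).2 hw0)).symm

theorem isDiscrete_of_rational' (hgen : ∀ z : F, ∃ f g : K[X], z = aeval w f / aeval w g)
    (hgen' : ∀ z : F, ∃ f g : K[X], z = aeval w⁻¹ f / aeval w⁻¹ g) (P : Place K F) :
    P.IsDiscrete := by
  rcases le_total (P.val w) 1 with h | h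
  · exact isDiscrete_of_rational hgen h
  · refine isDiscrete_of_rational hgen' ?_
    rw [map_inv₀]
    exact inv_le_one_of_one_le₀ h

end Rational

/-! ### The recursion `y² = (g² + 1)/(2g)` at one place -/

section Recursion

variable {K F : Type*} [Field K] [Field F] [Algebra K F] {P : Place K F} {g y : F}

theorem HasValue.unique {a b : OnePoint K} (ha : P.HasValue g a) (hb : P.HasValue g b) :
    a = b := by
  induction a with
  | infty =>
    induction b with
    | infty => rfl
    | coe b =>
      rw [hasValue_infty] at ha
      rw [hasValue_coe] at hb
      have := Valuation.map_add_le _ hb.le (P.val_algebraMap_le b)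
      rw [sub_add_cancel] at this
      exact absurd ha (not_lt.2 this)
  | coe a =>
    induction b with
    | infty =>
      rw [hasValue_infty] at hb
      rw [hasValue_coe] at ha
      have := Valuation.map_add_le _ ha.le (P.val_algebraMap_le a)
      rw [sub_add_cancel] at this
      exact absurd hb (not_lt.2 this)
    | coe b =>
      rw [hasValue_coe] at ha hb
      by_contra hne
      have h1 : b - a ≠ 0 := fun h => hne (by rw [sub_eq_zero.1 h])
      have h2 := P.val.map_sub_lt ha hb
      rw [sub_sub_sub_cancel_left, ← map_sub, P.val_algebraMap h1] at h2
      exact h2.false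

theorem HasValue.val_eq_one {a : K} (h : P.HasValue g a) (ha : a ≠ 0) : P.val g = 1 := by
  rw [hasValue_coe, Valuation.map_sub_swap] at h
  exact val_eq_one_of_sub (P.val_algebraMap ha) h

theorem val_two (h2 : (2 : K) ≠ 0) (P : Place K F) : P.val 2 = 1 := by
  have := P.val_algebraMap h2
  rwa [map_ofNat] at this

theorem val_sq_sub_lt_iff {c : K} :
    P.val (g ^ 2 - algebraMap K F (c ^ 2)) < 1 ↔
      P.HasValue g c ∨ P.HasValue g ((-c : K) : OnePoint K) := by
  rw [hasValue_coe, hasValue_coe, map_neg, sub_neg_eq_add, map_pow,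
    show g ^ 2 - algebraMap K F c ^ 2 = (g - algebraMap K F c) * (g + algebraMap K F c) by ring,
    map_mul]
  constructor
  · intro h
    by_contra! h1
    exact absurd h (not_lt.2 (one_le_mul h1.1 h1.2))
  · have key : ∀ {d : K}, P.val (g - algebraMap K F d) < 1 →
        P.val (g + algebraMap K F d) ≤ 1 := by
      intro d hd
      have := Valuation.map_add_le _ hd.le (P.val_algebraMap_le (d + d))
      rwa [map_add (algebraMap K F), sub_add_add_cancel] at this
    rintro (h | h)
    · exact mul_lt_one_of_lt_of_le h (key h)
    · refine mul_lt_one_of_nonneg_of_lt_one_right ?_ zero_le h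
      have := key (d := -c) (by rwa [map_neg, sub_neg_eq_add])
      rwa [map_neg, ← sub_eq_add_neg] at this

theorem val_ne_one_iff : P.val g ≠ 1 ↔ P.HasValue g ((0 : K) : OnePoint K) ∨ P.HasValue g ∞ := by
  rw [hasValue_infty, hasValue_coe, map_zero, sub_zero, lt_or_lt_iff_ne]

theorem val_rec (h2 : (2 : K) ≠ 0) (hy : y ^ 2 = (g ^ 2 + 1) / (2 * g)) :
    P.val y ^ 2 = P.val (g ^ 2 + 1) / P.val g := by
  rw [← map_pow, hy, map_div₀, map_mul, P.val_two h2, one_mul]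

/-- As `y² = (g + 1/g)/2`, a pole of `y` comes from a pole or a zero of `g`; at a unit `g` both
terms are integral. -/
theorem one_lt_val_iff (h2 : (2 : K) ≠ 0) (hg : g ≠ 0) (hy : y ^ 2 = (g ^ 2 + 1) / (2 * g)) :
    1 < P.val y ↔ P.val g ≠ 1 := by
  have h0 : 0 < P.val g := (Valuation.pos_iff _).2 hg
  have hsq : 1 < P.val y ↔ 1 < P.val y ^ 2 := (one_lt_pow_iff_of_nonneg zero_le two_ne_zero).symm
  rw [hsq, val_rec h2 hy]
  rcases lt_trichotomy (P.val g) 1 with h | h | h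
  · have h1 : P.val (g ^ 2 + 1) = 1 := by
      rw [Valuation.map_add_eq_of_lt_right, map_one]
      rw [map_one, map_pow]; exact pow_lt_one₀ zero_le h two_ne_zero
    rw [h1, one_div, one_lt_inv₀ h0]
    exact ⟨fun h => h.ne, fun _ => h⟩
  · rw [h, div_one]
    simp only [ne_eq, not_true_eq_false, iff_false, not_lt]
    exact Valuation.map_add_le _ (by rw [map_pow, h, one_pow]) (by simp)
  · have h1 : P.val (g ^ 2 + 1) = P.val g ^ 2 := by
      rw [Valuation.map_add_eq_of_lt_left, map_pow]
      rw [map_one, map_pow]; exact one_lt_pow₀ h two_ne_zero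
    rw [h1, pow_two, mul_div_assoc, div_self h0.ne', mul_one]
    exact ⟨fun h => h.ne', fun _ => h⟩

theorem val_lt_one_iff_of_rec (h2 : (2 : K) ≠ 0) (hg : g ≠ 0)
    (hy : y ^ 2 = (g ^ 2 + 1) / (2 * g)) : P.val y < 1 ↔ P.val (g ^ 2 + 1) < 1 := by
  by_cases h : P.val g = 1
  · rw [← pow_lt_one_iff_of_nonneg (zero_le : 0 ≤ P.val y) two_ne_zero, val_rec h2 hy, h, div_one]
  · have h1 := (one_lt_val_iff (P := P) h2 hg hy).2 h
    refine ⟨fun h3 => absurd h3 h1.le.not_gt, fun h3 => ?_⟩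
    exfalso
    have h4 : P.val (g ^ 2) ≠ P.val 1 := by
      rw [map_pow, map_one]
      exact fun h5 => h ((pow_eq_one_iff_of_nonneg zero_le two_ne_zero).1 h5)
    rw [Valuation.map_add_of_distinct_val _ h4, max_lt_iff, map_one] at h3
    exact h3.2.false

/-- Because `γ² = 1`, the difference `y² - γ` equals `(g - γ)² / (2g)`. -/
theorem hasValue_iff_of_rec (h2 : (2 : K) ≠ 0) (hg : g ≠ 0)
    (hy : y ^ 2 = (g ^ 2 + 1) / (2 * g)) {γ : K} (hγ : γ ^ 2 = 1) :
    P.val (y ^ 2 - algebraMap K F γ) < 1 ↔ P.HasValue g γ := by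
  have h2F : (2 : F) ≠ 0 := by
    have : algebraMap K F 2 ≠ 0 := by simpa using h2
    rwa [map_ofNat] at this
  have hγ0 : γ ≠ 0 := by rintro rfl; simp at hγ
  by_cases h : P.val g = 1
  · have h1 : y ^ 2 - algebraMap K F γ = (g - algebraMap K F γ) ^ 2 / (2 * g) := by
      have h3 : algebraMap K F γ ^ 2 = 1 := by rw [← map_pow, hγ, map_one]
      rw [hy]
      field_simp
      linear_combination -h3
    rw [h1, map_div₀, map_mul, P.val_two h2, h, one_mul, div_one, map_pow, hasValue_coe,
      pow_lt_one_iff_of_nonneg zero_le two_ne_zero]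
  · have h1 := (one_lt_val_iff (P := P) h2 hg hy).2 h
    refine ⟨fun h3 => ?_, fun h3 => absurd (h3.val_eq_one hγ0) h⟩
    exfalso
    have h4 := Valuation.map_add_le _ h3.le (P.val_algebraMap_le γ)
    rw [sub_add_cancel, map_pow] at h4
    exact absurd h4 (not_le.2 (one_lt_pow₀ h1 two_ne_zero))

/-- In `(g + 1/g)/2` the summand with a pole dominates; the symmetry between `g` and `1/g` accounts
for the absolute value. -/
theorem HasOrd.rec_of_ne_zero (h2 : (2 : K) ≠ 0) {n : ℤ} (hg : P.HasOrd g n) (hn : n ≠ 0) :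
    P.HasOrd ((g ^ 2 + 1) / (2 * g)) (-|n|) := by
  obtain ⟨t, ht⟩ := hg.exists_isUnif
  have h2' : P.HasOrd (2 * g) n := hg.of_val_eq (by rw [map_mul, P.val_two h2, one_mul])
  rcases lt_or_gt_of_ne hn with h | h
  · have h1 : 1 < P.val g := hg.one_lt_val_iff.2 h
    have h3 : P.HasOrd (g ^ 2 + 1) ((2 : ℕ) * n) := by
      refine (hg.pow 2).of_val_eq (Valuation.map_add_eq_of_lt_left _ ?_)
      rw [map_one, map_pow]; exact one_lt_pow₀ h1 two_ne_zero
    have := h3.div h2'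
    rw [abs_of_neg h]
    convert this using 1
    push_cast; ring
  · have h1 : P.val g < 1 := hg.val_lt_one_iff.2 h
    have h3 : P.HasOrd (g ^ 2 + 1) 0 := by
      refine ht.hasOrd_zero ?_
      rw [Valuation.map_add_eq_of_lt_right, map_one]
      rw [map_one, map_pow]; exact pow_lt_one₀ zero_le h1 two_ne_zero
    have := h3.div h2'
    rw [abs_of_pos h]
    convert this using 1
    ring

end Recursion

end Place

/-! ### The fields of the tower and restriction of places -/

section Tower

variable {K L : Type*} [Field K] [Field L] [Algebra K L] {x : ℕ → L}

theorem towerField_mono (x : ℕ → L) {r j : ℕ} (h : r ≤ j) : towerField K x r ≤ towerField K x j :=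
  IntermediateField.adjoin.mono _ _ _ (Set.image_mono (Set.Iic_subset_Iic.2 h))

/-- The inclusion of the fields of the tower. -/
noncomputable abbrev towerIncl (K : Type*) {L : Type*} [Field K] [Field L] [Algebra K L]
    (x : ℕ → L) {r j : ℕ} (h : r ≤ j) : towerField K x r →ₐ[K] towerField K x j :=
  IntermediateField.inclusion (towerField_mono x h)

/-- The square of the next generator of the tower. -/
noncomputable def towerSq (K : Type*) {L : Type*} [Field K] [Field L] [Algebra K L]
    (x : ℕ → L) (j : ℕ) : towerField K x j :=
  (towerGen K x j ^ 2 + 1) / (2 * towerGen K x j)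

/-- The hypotheses on the sequence `x`. -/
structure IsTower (K : Type*) {L : Type*} [Field K] [Field L] [Algebra K L] (x : ℕ → L) :
    Prop where
  two_ne : (2 : K) ≠ 0
  transcendental : Transcendental K (x 0)
  sq_succ : ∀ j, x (j + 1) ^ 2 = (x j ^ 2 + 1) / (2 * x j)

open Place

theorem Place.liesOver_iff {r j : ℕ} (h : r ≤ j) {S : Place K (towerField K x j)}
    {P : Place K (towerField K x r)} : S.LiesOver P ↔ Over (towerIncl K x h) S P :=
  ⟨fun ⟨_, h'⟩ => h', fun h' => ⟨towerField_mono x h, h'⟩⟩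

theorem Place.hasRamificationIndex_of {r j e : ℕ} (h : r ≤ j) {S : Place K (towerField K x j)}
    {P : Place K (towerField K x r)} (hP : P.IsDiscrete) (hS : Over (towerIncl K x h) S P)
    (he : ∀ z n, P.HasOrd z n → S.HasOrd (towerIncl K x h z) (e * n)) :
    S.HasRamificationIndex P e := by
  obtain ⟨t, ht⟩ := hP.exists_isUnif
  exact ⟨towerField_mono x h, hS,
    ⟨⟨t, mem_ring_iff.2 ht.1.le⟩, isUniformizer_iff.2 ht⟩, he⟩

theorem towerIncl_towerIncl {q r j : ℕ} (h : q ≤ r) (h' : r ≤ j) (z : towerField K x q) :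
    towerIncl K x h' (towerIncl K x h z) = towerIncl K x (h.trans h') z :=
  IntermediateField.inclusion_inclusion _ _ z

theorem Place.over_trans {q r j : ℕ} {h : q ≤ r} {h' : r ≤ j} {S : Place K (towerField K x j)}
    {R : Place K (towerField K x r)} {P : Place K (towerField K x q)}
    (hS : Over (towerIncl K x h') S R) (hR : Over (towerIncl K x h) R P) :
    Over (towerIncl K x (h.trans h')) S P := by
  rw [over_iff] at *
  intro z
  rw [← hR, ← hS, towerIncl_towerIncl]

theorem Place.over_of_over {q r j : ℕ} {h : q ≤ r} {h' : r ≤ j} {S : Place K (towerField K x j)}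
    {R : Place K (towerField K x r)} {P : Place K (towerField K x q)}
    (hS : Over (towerIncl K x h') S R) (hP : Over (towerIncl K x (h.trans h')) S P) :
    Over (towerIncl K x h) R P := by
  rw [over_iff] at *
  intro z
  rw [← hP, ← hS, towerIncl_towerIncl]

theorem Place.over_self {j : ℕ} (h : j ≤ j) (S : Place K (towerField K x j)) :
    Over (towerIncl K x h) S S := by
  rw [over_iff]; intro z; rfl

theorem coe_towerGen (j : ℕ) : (towerGen K x j : L) = x j := rfl

theorem aeval_coe {E : IntermediateField K L} (w : E) (f : Polynomial K) :
    ((Polynomial.aeval w f : E) : L) = Polynomial.aeval (w : L) f :=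
  (Polynomial.aeval_algHom_apply E.val w f).symm

theorem exists_aeval_div {E : IntermediateField K L} {w : E}
    (h : E ≤ IntermediateField.adjoin K {(w : L)}) (z : E) : ∃ f g : Polynomial K,
    z = Polynomial.aeval w f / Polynomial.aeval w g := by
  obtain ⟨f, g, hfg⟩ := (IntermediateField.mem_adjoin_simple_iff K (z : L)).1 (h z.2)
  refine ⟨f, g, Subtype.ext ?_⟩
  rw [hfg]
  push_cast
  rw [aeval_coe, aeval_coe]

theorem towerField_zero_le : towerField K x 0 ≤
    IntermediateField.adjoin K {(towerGen K x 0 : L)} := by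
  refine IntermediateField.adjoin.mono _ _ _ ?_
  rintro _ ⟨j, hj, rfl⟩
  rw [Set.mem_Iic, Nat.le_zero] at hj
  subst hj; rfl

theorem towerField_zero_le_inv : towerField K x 0 ≤
    IntermediateField.adjoin K {(((towerGen K x 0)⁻¹ : towerField K x 0) : L)} := by
  refine towerField_zero_le.trans ?_
  rw [IntermediateField.adjoin_simple_le_iff]
  have := inv_mem (IntermediateField.mem_adjoin_simple_self K
    (((towerGen K x 0)⁻¹ : towerField K x 0) : L))
  simpa using this

/-- The set `E + E y` is closed under inverses by multiplying with the conjugate; a vanishing norm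
with `b ≠ 0` would put `y` into `E`. -/
theorem exists_add_mul_of_mem_adjoin {E : IntermediateField K L} {y : L} (hsq : y ^ 2 ∈ E)
    (hne : y ∉ E) {s : Set L} (hs : ∀ z ∈ s, z ∈ E ∨ z = y) {z : L}
    (hz : z ∈ IntermediateField.adjoin K s) : ∃ a ∈ E, ∃ b ∈ E, z = a + b * y := by
  induction hz using IntermediateField.adjoin_induction with
  | mem z hz =>
    rcases hs z hz with h | rfl
    · exact ⟨z, h, 0, zero_mem _, by simp⟩
    · exact ⟨0, zero_mem _, 1, one_mem _, by simp⟩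
  | algebraMap c => exact ⟨_, E.algebraMap_mem c, 0, zero_mem _, by simp⟩
  | add _ _ _ _ h h' =>
    obtain ⟨a, ha, b, hb, rfl⟩ := h
    obtain ⟨c, hc, d, hd, rfl⟩ := h'
    exact ⟨a + c, add_mem ha hc, b + d, add_mem hb hd, by ring⟩
  | mul _ _ _ _ h h' =>
    obtain ⟨a, ha, b, hb, rfl⟩ := h
    obtain ⟨c, hc, d, hd, rfl⟩ := h'
    exact ⟨a * c + b * d * y ^ 2, add_mem (mul_mem ha hc) (mul_mem (mul_mem hb hd) hsq),
      a * d + b * c, add_mem (mul_mem ha hd) (mul_mem hb hc), by ring⟩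
  | inv _ _ h =>
    obtain ⟨a, ha, b, hb, rfl⟩ := h
    by_cases h0 : (a - b * y) * (a + b * y) = 0
    · by_cases hb0 : b = 0
      · exact ⟨a⁻¹, inv_mem ha, 0, zero_mem _, by simp [hb0]⟩
      · exfalso
        rcases mul_eq_zero.1 h0 with h1 | h1
        · refine hne ?_
          rw [show y = a / b by field_simp; linear_combination -h1]
          exact div_mem ha hb
        · refine hne ?_
          rw [show y = -a / b by field_simp; linear_combination h1]
          exact div_mem (neg_mem ha) hb
    · have h2 := left_ne_zero_of_mul h0
      have h3 := right_ne_zero_of_mul h0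
      have hN : (a - b * y) * (a + b * y) ∈ E := by
        rw [show (a - b * y) * (a + b * y) = a ^ 2 - b ^ 2 * y ^ 2 by ring]
        exact sub_mem (pow_mem ha 2) (mul_mem (pow_mem hb 2) hsq)
      refine ⟨a / ((a - b * y) * (a + b * y)), div_mem ha hN, -b / ((a - b * y) * (a + b * y)),
        div_mem (neg_mem hb) hN, ?_⟩
      field_simp
      ring

namespace IsTower

theorem transcendental_gen (H : IsTower K x) : Transcendental K (towerGen K x 0) := by
  intro h
  exact H.transcendental (h.algebraMap (A := L))

theorem exists_place_zero (H : IsTower K x) (a : OnePoint K) : ∃ P : Place K (towerField K x 0),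
    (∀ S : Place K (towerField K x 0), S.HasValue (towerGen K x 0) a ↔ S = P) ∧ P.degree = 1 ∧
      P.HasOrd (localParam (towerGen K x 0) a) 1 :=
  exists_unique_hasValue (exists_aeval_div towerField_zero_le)
    (exists_aeval_div towerField_zero_le_inv) H.transcendental_gen a

theorem isDiscrete_zero (P : Place K (towerField K x 0)) : P.IsDiscrete :=
  isDiscrete_of_rational' (exists_aeval_div towerField_zero_le)
    (exists_aeval_div towerField_zero_le_inv) P

theorem gen_sq (H : IsTower K x) (j : ℕ) :
    towerGen K x (j + 1) ^ 2 = towerIncl K x j.le_succ (towerSq K x j) := by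
  apply Subtype.ext
  have := H.sq_succ j
  rw [IntermediateField.coe_inclusion, towerSq]
  push_cast
  rw [coe_towerGen, coe_towerGen]
  exact this

theorem isQuadratic_of_ne (H : IsTower K x) {j : ℕ}
    (hne : ∀ a, towerIncl K x j.le_succ a ≠ towerGen K x (j + 1)) :
    IsQuadratic (towerIncl K x j.le_succ) (towerGen K x (j + 1)) (towerSq K x j) where
  sq := H.gen_sq j
  ne := hne
  span z := by
    have hsq : x (j + 1) ^ 2 ∈ towerField K x j := by
      have := congrArg Subtype.val (H.gen_sq j)
      rw [IntermediateField.coe_inclusion] at this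
      rw [← coe_towerGen (K := K) (x := x), ← SubmonoidClass.coe_pow, this]
      exact (towerSq K x j).2
    obtain ⟨a, ha, b, hb, hab⟩ := exists_add_mul_of_mem_adjoin hsq
      (fun h => hne ⟨_, h⟩ (Subtype.ext (by rw [IntermediateField.coe_inclusion, coe_towerGen])))
      (s := x '' Set.Iic (j + 1)) (by
        rintro _ ⟨m, hm, rfl⟩
        rcases Nat.le_succ_iff.1 (Set.mem_Iic.1 hm) with hm | rfl
        · exact Or.inl (IntermediateField.subset_adjoin K _ ⟨m, hm, rfl⟩)
        · exact Or.inr rfl) z.2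
    refine ⟨⟨a, ha⟩, ⟨b, hb⟩, Subtype.ext ?_⟩
    rw [hab, AddMemClass.coe_add, MulMemClass.coe_mul, IntermediateField.coe_inclusion,
      IntermediateField.coe_inclusion, coe_towerGen]

/-- An element of odd order is not a square, so the next generator does not lie in the field below.
-/
theorem isQuadratic_of_odd (H : IsTower K x) {j : ℕ} {P : Place K (towerField K x j)}
    (hP : P.IsDiscrete) (hu : P.HasOrd (towerSq K x j) (-1)) :
    IsQuadratic (towerIncl K x j.le_succ) (towerGen K x (j + 1)) (towerSq K x j) := by
  refine H.isQuadratic_of_ne fun a ha => ?_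
  have h1 : a ^ 2 = towerSq K x j := by
    refine (towerIncl K x j.le_succ).toRingHom.injective ?_
    change towerIncl K x j.le_succ (a ^ 2) = towerIncl K x j.le_succ _
    rw [map_pow, ha, H.gen_sq]
  have ha0 : a ≠ 0 := by
    rintro rfl
    rw [zero_pow two_ne_zero] at h1
    exact hu.ne_zero h1.symm
  obtain ⟨n, hn⟩ := hP a ha0
  have h2 := hn.pow 2
  rw [h1] at h2
  have := h2.unique hu
  push_cast at this
  omega

/-- The simple pole of `x_0` persists: order -1 of `x_j` gives order -1 of `x_{j+1}²`, hence a
ramified step. This one chain of places shows on every level that `x_j` is nonzero and that the next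
step has degree two. -/
theorem exists_pole (H : IsTower K x) (j : ℕ) : ∃ P : Place K (towerField K x j),
    P.IsDiscrete ∧ P.HasOrd (towerGen K x j) (-1) := by
  induction j with
  | zero =>
    obtain ⟨P, -, -, h⟩ := H.exists_place_zero ∞
    refine ⟨P, isDiscrete_zero P, ?_⟩
    have : P.HasOrd (towerGen K x 0)⁻¹⁻¹ (-1) := h.inv
    rwa [inv_inv] at this
  | succ j ih =>
    obtain ⟨P, hP, h⟩ := ih
    have hu : P.HasOrd (towerSq K x j) (2 * (-1) + 1) :=
      h.rec_of_ne_zero H.two_ne (by decide)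
    have hq := H.isQuadratic_of_odd hP hu
    obtain ⟨Q, hQ⟩ := exists_over (towerIncl K x j.le_succ) P
    obtain ⟨h1, h2, -⟩ := hq.isDiscrete_of_odd hP hu hQ
    exact ⟨Q, h1, h2⟩

theorem gen_ne_zero (H : IsTower K x) (j : ℕ) : towerGen K x j ≠ 0 :=
  let ⟨_, _, h⟩ := H.exists_pole j; h.ne_zero

theorem isQuadratic (H : IsTower K x) (j : ℕ) :
    IsQuadratic (towerIncl K x j.le_succ) (towerGen K x (j + 1)) (towerSq K x j) := by
  obtain ⟨P, hP, h⟩ := H.exists_pole j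
  exact H.isQuadratic_of_odd hP (h.rec_of_ne_zero H.two_ne (by decide))

theorem exists_restrict_succ (H : IsTower K x) {j : ℕ} (S : Place K (towerField K x (j + 1))) :
    ∃ P, Over (towerIncl K x j.le_succ) S P :=
  ⟨S.comap _ ((H.isQuadratic j).comap_ne_top S), rfl⟩

theorem exists_restrict (H : IsTower K x) {r j : ℕ} (h : r ≤ j)
    (S : Place K (towerField K x j)) : ∃ P, Over (towerIncl K x h) S P := by
  induction j, h using Nat.le_induction with
  | base => exact ⟨S, over_self _ S⟩
  | succ j h ih =>
    obtain ⟨R, hR⟩ := H.exists_restrict_succ S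
    obtain ⟨P, hP⟩ := ih R
    exact ⟨P, over_trans hR hP⟩

theorem isDiscrete (H : IsTower K x) {j : ℕ} (S : Place K (towerField K x j)) :
    S.IsDiscrete := by
  induction j with
  | zero => exact isDiscrete_zero S
  | succ j ih =>
    obtain ⟨P, hP⟩ := H.exists_restrict_succ S
    exact (H.isQuadratic j).isDiscrete H.two_ne (ih P) hP

theorem gen_rec (H : IsTower K x) (j : ℕ) :
    towerGen K x (j + 1) ^ 2 = ((towerIncl K x j.le_succ (towerGen K x j)) ^ 2 + 1) /
      (2 * towerIncl K x j.le_succ (towerGen K x j)) := by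
  rw [H.gen_sq, towerSq]
  simp only [map_div₀, map_add, map_mul, map_pow, map_one, map_ofNat]

variable {j : ℕ} {S : Place K (towerField K x (j + 1))} {P : Place K (towerField K x j)}

theorem map_gen_ne_zero (H : IsTower K x) (j : ℕ) :
    towerIncl K x j.le_succ (towerGen K x j) ≠ 0 := by
  simpa using H.gen_ne_zero j

theorem hasValue_infty_iff (H : IsTower K x) (h : Over (towerIncl K x j.le_succ) S P) :
    S.HasValue (towerGen K x (j + 1)) ∞ ↔
      P.HasValue (towerGen K x j) ((0 : K) : OnePoint K) ∨ P.HasValue (towerGen K x j) ∞ := by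
  rw [hasValue_infty, one_lt_val_iff H.two_ne (H.map_gen_ne_zero j) (H.gen_rec j), Ne,
    h.val_eq_one, ← Ne, val_ne_one_iff]

theorem hasValue_zero_iff (H : IsTower K x) {i : K} (hi : i ^ 2 = -1)
    (h : Over (towerIncl K x j.le_succ) S P) :
    S.HasValue (towerGen K x (j + 1)) ((0 : K) : OnePoint K) ↔
      P.HasValue (towerGen K x j) i ∨ P.HasValue (towerGen K x j) ((-i : K) : OnePoint K) := by
  rw [hasValue_coe, map_zero, sub_zero,
    val_lt_one_iff_of_rec H.two_ne (H.map_gen_ne_zero j) (H.gen_rec j), ← val_sq_sub_lt_iff, hi,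
    ← h.val_lt_one]
  simp

/-- Used with `c = 1`, where the values 1 and -1 come from 1, and with `c = i`, where the values `i`
and `-i` come from -1. -/
theorem hasValue_sq_iff (H : IsTower K x) {c : K} (hc : c ^ 4 = 1)
    (h : Over (towerIncl K x j.le_succ) S P) :
    S.HasValue (towerGen K x (j + 1)) c ∨
        S.HasValue (towerGen K x (j + 1)) ((-c : K) : OnePoint K) ↔
      P.HasValue (towerGen K x j) ((c ^ 2 : K) : OnePoint K) := by
  rw [← val_sq_sub_lt_iff, hasValue_iff_of_rec H.two_ne (H.map_gen_ne_zero j) (H.gen_rec j)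
    (by rw [← pow_mul, hc]), h.hasValue]

end IsTower

/-! ### Places where `x_j` is a fourth root of unity -/

theorem Place.LiesOver.over {r j : ℕ} {S : Place K (towerField K x j)}
    {P : Place K (towerField K x r)} (h : S.LiesOver P) (hrj : r ≤ j) :
    Over (towerIncl K x hrj) S P := (liesOver_iff hrj).1 h

/-- `P` is the only place of `T_j` where `x_j` takes the value `c`, its degree is one, and
`x_j - c` has order `2 ^ j` there. -/
structure IsSimplePlace {j : ℕ} (c : K) (P : Place K (towerField K x j)) : Prop where
  hasValue_iff : ∀ S : Place K (towerField K x j), S.HasValue (towerGen K x j) c ↔ S = P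
  hasOrd : P.HasOrd (towerGen K x j - algebraMap K _ c) (2 ^ j)
  degree : P.degree = 1

namespace IsSimplePlace

variable {j : ℕ} {c : K} {P : Place K (towerField K x j)} {S : Place K (towerField K x (j + 1))}

theorem hasValue (hP : IsSimplePlace c P) : P.HasValue (towerGen K x j) c :=
  (hP.hasValue_iff P).2 rfl

/-- As `c⁴ = 1`, the difference is `(x_j - c²)² / (2 x_j)` with `x_j` a unit, so the order `2 ^ j`
doubles. -/
theorem hasOrd_sq_sub (H : IsTower K x) (hc : c ^ 4 = 1) (hP : IsSimplePlace (c ^ 2) P) :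
    P.HasOrd (towerSq K x j - algebraMap K _ c ^ 2) (2 ^ (j + 1)) := by
  have hc0 : c ^ 2 ≠ 0 := by
    intro h0
    rw [show c ^ 4 = (c ^ 2) ^ 2 by ring, h0] at hc
    simp at hc
  have hg := hP.hasValue.val_eq_one hc0
  have h1 := hP.hasOrd.pow 2
  have h2 : P.HasOrd (2 * towerGen K x j) 0 := by
    refine (H.isDiscrete P).hasOrd_zero ?_
    rw [map_mul, P.val_two H.two_ne, hg, mul_one]
  have h3 := h1.div h2
  have h2' : (2 : towerField K x j) ≠ 0 := left_ne_zero_of_mul h2.ne_zero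
  have hg0 := H.gen_ne_zero j
  have h4 : (algebraMap K (towerField K x j) c) ^ 4 = 1 := by rw [← map_pow, hc, map_one]
  convert h3 using 1
  · rw [towerSq, map_pow]
    field_simp
    linear_combination -h4
  · push_cast; ring

theorem val_sq_sub_lt (H : IsTower K x) (hc : c ^ 4 = 1) (hP : IsSimplePlace (c ^ 2) P) :
    P.val (towerSq K x j - algebraMap K _ c ^ 2) < 1 :=
  (hP.hasOrd_sq_sub H hc).val_lt_one_iff.2 (by positivity)

theorem val_algebraMap_of_pow (hc : c ^ 4 = 1) : P.val (algebraMap K _ c) = 1 :=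
  P.val_algebraMap (by rintro rfl; simp at hc)

theorem val_sq (H : IsTower K x) (hc : c ^ 4 = 1) (hP : IsSimplePlace (c ^ 2) P) :
    P.val (towerSq K x j) = 1 := by
  have h := hP.val_sq_sub_lt H hc
  rw [Valuation.map_sub_swap] at h
  refine val_eq_one_of_sub ?_ h
  rw [map_pow, val_algebraMap_of_pow hc, one_pow]

theorem over_of_hasValue (H : IsTower K x) (hc : c ^ 4 = 1) (hP : IsSimplePlace (c ^ 2) P)
    (hS : S.HasValue (towerGen K x (j + 1)) c) : Over (towerIncl K x j.le_succ) S P := by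
  obtain ⟨R, hR⟩ := H.exists_restrict_succ S
  have := (H.hasValue_sq_iff hc hR).1 (Or.inl hS)
  rw [hP.hasValue_iff] at this
  rwa [← this]

theorem val_sub_iff : S.HasValue (towerGen K x (j + 1)) c ↔
    S.val (towerGen K x (j + 1) - towerIncl K x j.le_succ (algebraMap K _ c)) < 1 := by
  rw [hasValue_coe, AlgHom.commutes]

/-- Over the place with `x_j = c²` the step splits into `c` and `-c`. The branch at `c` keeps degree
one, and `x_{j+1} - c` inherits the order of `x_{j+1}² - c²`. -/
theorem exists_succ (H : IsTower K x) (hc : c ^ 4 = 1) (hP : IsSimplePlace (c ^ 2) P) :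
    ∃ S : Place K (towerField K x (j + 1)), IsSimplePlace c S := by
  have hu := hP.val_sq H hc
  have hq := H.isQuadratic j
  obtain ⟨S, hS, hSc⟩ := hq.exists_split (hP.val_sq_sub_lt H hc)
  refine ⟨S, fun R => ⟨fun hR => ?_, ?_⟩, ?_, ?_⟩
  · exact hq.eq_of_split H.two_ne hu (hP.over_of_hasValue H hc hR) hS (val_sub_iff.1 hR) hSc
  · rintro rfl; exact val_sub_iff.2 hSc
  · have := hq.hasOrd_sub H.two_ne hu (H.isDiscrete P) hS (val_algebraMap_of_pow hc) hSc
      (hP.hasOrd_sq_sub H hc)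
    rwa [AlgHom.commutes] at this
  · rw [hq.degree_of_split H.two_ne hu hS (val_algebraMap_of_pow hc) hSc, hP.degree]

theorem hasRamificationIndex (H : IsTower K x) (hc : c ^ 4 = 1) (hP : IsSimplePlace (c ^ 2) P)
    (h : Over (towerIncl K x j.le_succ) S P) : S.HasRamificationIndex P 1 := by
  refine hasRamificationIndex_of j.le_succ (H.isDiscrete P) h fun z n hz => ?_
  rw [Nat.cast_one, one_mul]
  exact ((H.isQuadratic j).isDiscrete_of_unit H.two_ne (hP.val_sq H hc) (H.isDiscrete P) h).2 z n hz

theorem over_iff_of_sq (H : IsTower K x) (hc : c ^ 4 = 1) (hP : IsSimplePlace (c ^ 2) P)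
    {Q Q' : Place K (towerField K x (j + 1))} (hQ : IsSimplePlace c Q)
    (hQ' : IsSimplePlace (-c) Q') : Over (towerIncl K x j.le_succ) S P ↔ S = Q ∨ S = Q' := by
  rw [← hQ.hasValue_iff, ← hQ'.hasValue_iff]
  constructor
  · intro h
    exact (H.hasValue_sq_iff hc h).2 hP.hasValue
  · rintro (h | h)
    · exact hP.over_of_hasValue H hc h
    · exact over_of_hasValue H (c := -c) (by rwa [Even.neg_pow (by decide)])
        (by rwa [neg_sq]) h

theorem hasOrd_sq_add_one (H : IsTower K x) {i : K} (hi : i ^ 2 = -1) (hP : IsSimplePlace i P) :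
    P.HasOrd (towerGen K x j ^ 2 + 1) (2 ^ j) := by
  refine hP.hasOrd.of_val_eq ?_
  -- The lemma is used along the identity of `T_j`: where `x_j = i`, the cofactor `x_j + i` of `x_j²
  -- + 1` is a unit.
  have h1 := IsQuadratic.val_add_eq_one (φ := AlgHom.id K (towerField K x j)) H.two_ne
    (Q := P) (P := P) rfl (y := towerGen K x j) (c := algebraMap K _ i)
    (val_algebraMap_of_pow (by linear_combination (i ^ 2 - 1) * hi)) (hasValue_coe.1 hP.hasValue)
  have h2 : towerGen K x j ^ 2 + 1 = (towerGen K x j - algebraMap K _ i) *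
      (towerGen K x j + algebraMap K _ i) := by
    have : (algebraMap K (towerField K x j) i) ^ 2 = -1 := by rw [← map_pow, hi, map_neg, map_one]
    linear_combination this
  rw [h2, map_mul, show P.val (towerGen K x j + algebraMap K _ i) = 1 from h1, mul_one]

theorem hasOrd_sq (H : IsTower K x) {i : K} (hi : i ^ 2 = -1) (hP : IsSimplePlace i P) :
    P.HasOrd (towerSq K x j) (2 ^ j) := by
  refine (hP.hasOrd_sq_add_one H hi).of_val_eq ?_
  have hi0 : i ≠ 0 := by rintro rfl; simp at hi
  rw [towerSq, map_div₀, map_mul, P.val_two H.two_ne, hP.hasValue.val_eq_one hi0, mul_one, div_one]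

end IsSimplePlace

/-! ### Existence of the simple and the totally ramified places -/

namespace IsTower

theorem exists_isSimplePlace_zero (H : IsTower K x) (c : K) :
    ∃ P : Place K (towerField K x 0), IsSimplePlace c P := by
  obtain ⟨P, h1, h2, h3⟩ := H.exists_place_zero (c : OnePoint K)
  exact ⟨P, h1, by simpa [localParam] using h3, h2⟩

theorem exists_isSimplePlace_one (H : IsTower K x) {j : ℕ} {c : K} (hc : c ^ 2 = 1) :
    ∃ P : Place K (towerField K x j), IsSimplePlace c P := by
  induction j generalizing c with
  | zero => exact H.exists_isSimplePlace_zero c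
  | succ j ih =>
    obtain ⟨P, hP⟩ := ih (one_pow 2)
    exact IsSimplePlace.exists_succ H (by linear_combination (c ^ 2 + 1) * hc) (hc ▸ hP)

/-- The square of a fourth root of unity is 1 or -1, and the place for that value one level lower is
already available. -/
theorem exists_isSimplePlace (H : IsTower K x) {j : ℕ} {c : K} (hc : c ^ 4 = 1) :
    ∃ P : Place K (towerField K x j), IsSimplePlace c P := by
  rcases j with _ | j
  · exact H.exists_isSimplePlace_zero c
  · obtain ⟨P, hP⟩ := H.exists_isSimplePlace_one (j := j) (c := c ^ 2) (by rw [← pow_mul, hc])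
    exact IsSimplePlace.exists_succ H hc hP

variable {j r : ℕ}

/-- The function `x_0` in `T_j`. -/
noncomputable abbrev base (K : Type*) {L : Type*} [Field K] [Field L] [Algebra K L]
    (x : ℕ → L) (j : ℕ) : towerField K x j := towerIncl K x j.zero_le (towerGen K x 0)

theorem hasValue_base {h : r ≤ j} {S : Place K (towerField K x j)}
    {R : Place K (towerField K x r)} (hS : Over (towerIncl K x h) S R) (a : OnePoint K) :
    S.HasValue (base K x j) a ↔ R.HasValue (base K x r) a := by
  rw [← hS.hasValue, towerIncl_towerIncl]

theorem base_zero : base K x 0 = towerGen K x 0 := by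
  apply Subtype.ext
  rw [IntermediateField.coe_inclusion]

/-- The order of `(x_j ^ 2 + 1) / (2 x_j)` at the totally ramified places. -/
noncomputable def totalOrd (i : K) (j : ℕ) (a : OnePoint K) : ℤ :=
  open Classical in if j = 0 ∧ (a = i ∨ a = ((-i : K) : OnePoint K)) then 1 else -1

/-- The order of `u_j` is 1 or -1, hence odd. The ramified step hands it on to `x_{j+1}`, and then
`u_{j+1}` has order -1. The places are characterized by the value of `x_0` rather than of `x_j`. -/
theorem exists_total (H : IsTower K x) {i : K} (hi : i ^ 2 = -1) (j : ℕ) {a : OnePoint K}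
    (ha : a ∈ totalValues i) : ∃ P : Place K (towerField K x j),
      (∀ S : Place K (towerField K x j), S.HasValue (base K x j) a ↔ S = P) ∧
      P.HasOrd (towerSq K x j) (totalOrd i j a) := by
  have hi0 : i ≠ 0 := by rintro rfl; simp at hi
  induction j with
  | zero =>
    obtain ⟨P, h1, -, h3⟩ := H.exists_place_zero a
    refine ⟨P, by rwa [base_zero], ?_⟩
    rw [totalOrd]
    have key : ∀ b : K, b ^ 2 = -1 → a = b → P.HasOrd (towerSq K x 0) 1 := by
      rintro b hb rfl
      obtain ⟨Q, hQ⟩ := H.exists_isSimplePlace_zero b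
      have : P = Q := (hQ.hasValue_iff P).1 ((h1 P).2 rfl)
      subst this
      simpa using hQ.hasOrd_sq H hb
    rcases ha with rfl | rfl | rfl | rfl
    · rw [if_neg (by simp)]
      have h4 : P.HasOrd (towerGen K x 0)⁻¹⁻¹ (-1) := h3.inv
      rw [inv_inv] at h4
      exact h4.rec_of_ne_zero H.two_ne (by decide)
    · rw [if_neg (by simp [hi0.symm, hi0])]
      have h4 : P.HasOrd (towerGen K x 0) 1 := by simpa [localParam] using h3
      exact h4.rec_of_ne_zero H.two_ne (by decide)
    · rw [if_pos (by simp)]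
      exact key i hi rfl
    · rw [if_pos (by simp)]
      exact key (-i) (by rw [neg_sq, hi]) rfl
  | succ j ih =>
    obtain ⟨P, h1, h2⟩ := ih
    obtain ⟨S, hS⟩ := exists_over (towerIncl K x j.le_succ) P
    have hm : totalOrd i j a = 1 ∨ totalOrd i j a = -1 := by
      rw [totalOrd]; split_ifs <;> simp
    obtain ⟨k, hk⟩ : ∃ k, totalOrd i j a = 2 * k + 1 := by
      rcases hm with h | h
      · exact ⟨0, h⟩
      · exact ⟨-1, by rw [h]; rfl⟩
    rw [hk] at h2
    have hq := H.isQuadratic j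
    refine ⟨S, fun R => ⟨fun hR => ?_, ?_⟩, ?_⟩
    · obtain ⟨R', hR'⟩ := H.exists_restrict_succ R
      rw [hasValue_base hR', h1] at hR
      subst hR
      exact hq.over_unique_of_odd (H.isDiscrete _) h2 hR' hS
    · rintro rfl
      rw [hasValue_base hS, h1]
    · have h4 := (hq.isDiscrete_of_odd (H.isDiscrete P) h2 hS).2.1.rec_of_ne_zero H.two_ne
        (by omega)
      rw [← hk] at h4
      rw [totalOrd, if_neg (by simp)]
      rcases hm with h | h <;> rw [h] at h4 <;> exact h4

/-! ### Sums of degrees -/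

/-- Fibres over different places are disjoint because the restriction of a place is unique. -/
theorem finsum_degree {A : Set (Place K (towerField K x j))} (hA : A.Finite) {d : ℕ}
    (h : ∀ R ∈ A, {S | Over (towerIncl K x j.le_succ) S R}.Finite ∧
      ∑ᶠ S ∈ {S | Over (towerIncl K x j.le_succ) S R}, S.degree = d * R.degree) :
    {S | ∃ R ∈ A, Over (towerIncl K x j.le_succ) S R}.Finite ∧
      ∑ᶠ S ∈ {S | ∃ R ∈ A, Over (towerIncl K x j.le_succ) S R}, S.degree =
        d * ∑ᶠ R ∈ A, R.degree := by
  have hset : {S | ∃ R ∈ A, Over (towerIncl K x j.le_succ) S R} =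
      ⋃ R ∈ A, {S | Over (towerIncl K x j.le_succ) S R} := by
    ext S; simp
  rw [hset]
  refine ⟨hA.biUnion fun R hR => (h R hR).1, ?_⟩
  rw [finsum_mem_biUnion ?_ hA fun R hR => (h R hR).1, mul_finsum_mem]
  · exact finsum_mem_congr rfl fun R hR => (h R hR).2
  · intro R _ R' _ hne
    refine Set.disjoint_left.2 fun S hS hS' => hne ?_
    exact Over.unique hS hS'

theorem liesOver_succ_iff (H : IsTower K x) (h : r ≤ j) {P : Place K (towerField K x r)} :
    {S : Place K (towerField K x (j + 1)) | S.LiesOver P} =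
      {S | ∃ R ∈ {R : Place K (towerField K x j) | R.LiesOver P},
        Over (towerIncl K x j.le_succ) S R} := by
  ext S
  constructor
  · intro hS
    obtain ⟨R, hR⟩ := H.exists_restrict_succ S
    exact ⟨R, (liesOver_iff h).2 (over_of_over hR (hS.over (h.trans j.le_succ))), hR⟩
  · rintro ⟨R, hR, hSR⟩
    exact (liesOver_iff _).2 (over_trans hSR (LiesOver.over hR h))

theorem liesOver_even (H : IsTower K x) (h : r ≤ j) {P : Place K (towerField K x r)} {k : ℤ}
    (hfin : {R : Place K (towerField K x j) | R.LiesOver P}.Finite)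
    (hu : ∀ R : Place K (towerField K x j), R.LiesOver P → R.HasOrd (towerSq K x j) (2 * k)) :
    {S : Place K (towerField K x (j + 1)) | S.LiesOver P}.Finite ∧
    ∑ᶠ S ∈ {S : Place K (towerField K x (j + 1)) | S.LiesOver P}, S.degree =
      2 * ∑ᶠ R ∈ {R : Place K (towerField K x j) | R.LiesOver P}, R.degree ∧
    ∀ S : Place K (towerField K x (j + 1)), S.LiesOver P →
      (∃ R : Place K (towerField K x j), R.LiesOver P ∧ S.HasRamificationIndex R 1) ∧
      S.HasOrd (towerGen K x (j + 1)) k := by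
  have hq := H.isQuadratic j
  have h1 := finsum_degree hfin fun R hR => hq.fiber_of_even H.two_ne (hu R hR)
  rw [← H.liesOver_succ_iff h] at h1
  refine ⟨h1.1, h1.2, fun S hS => ?_⟩
  obtain ⟨R, hR, hSR⟩ := (H.liesOver_succ_iff h).le hS
  obtain ⟨-, h2, h3⟩ := hq.isDiscrete_of_even H.two_ne (H.isDiscrete R) (hu R hR) hSR
  refine ⟨⟨R, hR, hasRamificationIndex_of _ (H.isDiscrete R) hSR fun z n hz => ?_⟩, h2⟩
  rw [Nat.cast_one, one_mul]
  exact h3 z n hz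

theorem liesOver_odd (H : IsTower K x) (h : r ≤ j) {P : Place K (towerField K x r)} {k : ℤ}
    (hfin : {R : Place K (towerField K x j) | R.LiesOver P}.Finite)
    (hu : ∀ R : Place K (towerField K x j), R.LiesOver P →
      R.HasOrd (towerSq K x j) (2 * k + 1)) :
    {S : Place K (towerField K x (j + 1)) | S.LiesOver P}.Finite ∧
    ∑ᶠ S ∈ {S : Place K (towerField K x (j + 1)) | S.LiesOver P}, S.degree =
      ∑ᶠ R ∈ {R : Place K (towerField K x j) | R.LiesOver P}, R.degree ∧
    ∀ S : Place K (towerField K x (j + 1)), S.LiesOver P →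
      (∃ R : Place K (towerField K x j), R.LiesOver P ∧ S.HasRamificationIndex R 2) ∧
      S.HasOrd (towerGen K x (j + 1)) (2 * k + 1) := by
  have hq := H.isQuadratic j
  have h1 := finsum_degree hfin fun R hR => hq.fiber_of_odd (H.isDiscrete R) (hu R hR)
  rw [← H.liesOver_succ_iff h, one_mul] at h1
  refine ⟨h1.1, h1.2, fun S hS => ?_⟩
  obtain ⟨R, hR, hSR⟩ := (H.liesOver_succ_iff h).le hS
  obtain ⟨-, h2, h3⟩ := hq.isDiscrete_of_odd (H.isDiscrete R) (hu R hR) hSR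
  exact ⟨⟨R, hR, hasRamificationIndex_of _ (H.isDiscrete R) hSR h3⟩, h2⟩

theorem liesOver_base (H : IsTower K x) {i : K} (hi : i ^ 2 = -1)
    {P : Place K (towerField K x r)} (hP : IsSimplePlace (-1) P)
    {Q Q' : Place K (towerField K x (r + 1))} (hQ : IsSimplePlace i Q)
    (hQ' : IsSimplePlace (-i) Q') (S : Place K (towerField K x (r + 1))) :
    S.LiesOver P ↔ S = Q ∨ S = Q' := by
  rw [liesOver_iff r.le_succ]
  exact IsSimplePlace.over_iff_of_sq H (by linear_combination (i ^ 2 - 1) * hi) (hi ▸ hP) hQ hQ'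

theorem ne_neg (H : IsTower K x) {c : K} (hc : c ≠ 0) : c ≠ -c := by
  intro h
  have : 2 * c = 0 := by linear_combination h
  exact (mul_ne_zero H.two_ne hc) this

/-- Parts (c) and (d) together, with `k = j - r - 2`. The order of `x` starts at `2 ^ r`, turns
negative at the next step, and its absolute value halves while it is even: `r` further unramified
steps. For `k > r` the truncated `r - k` is zero, which gives the stationary order -1 of the
ramified range. -/
theorem liesOver_main (H : IsTower K x) {i : K} (hi : i ^ 2 = -1)
    {P : Place K (towerField K x r)} (hP : IsSimplePlace (-1) P) (k : ℕ) :
    {S : Place K (towerField K x (r + 2 + k)) | S.LiesOver P}.Finite ∧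
    ∑ᶠ S ∈ {S : Place K (towerField K x (r + 2 + k)) | S.LiesOver P}, S.degree =
      2 ^ (min k r + 2) ∧
    ∀ S : Place K (towerField K x (r + 2 + k)), S.LiesOver P →
      (∃ R : Place K (towerField K x (r + 2 + k - 1)), R.LiesOver P ∧
        S.HasRamificationIndex R (if k ≤ r then 1 else 2)) ∧
      S.HasOrd (towerGen K x (r + 2 + k)) (if k = 0 then 2 ^ r else -2 ^ (r - k)) := by
  have hi0 : i ≠ 0 := by rintro rfl; simp at hi
  induction k with
  | zero =>
    -- On level `r + 1` there are two places of degree one, where `x_{r+1} = ±i` and `u` has order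
    -- `2 ^ (r + 1)`; this even order makes the step to level `r + 2` unramified.
    obtain ⟨Q, hQ⟩ := H.exists_isSimplePlace (j := r + 1) (c := i)
      (by linear_combination (i ^ 2 - 1) * hi)
    obtain ⟨Q', hQ'⟩ := H.exists_isSimplePlace (j := r + 1) (c := -i)
      (by linear_combination (i ^ 2 - 1) * hi)
    have hi' : (-i) ^ 2 = -1 := by rw [neg_sq, hi]
    have hover := H.liesOver_base hi hP hQ hQ'
    have hset : {S : Place K (towerField K x (r + 1)) | S.LiesOver P} = {Q, Q'} :=
      Set.ext hover
    have hne : Q ≠ Q' := by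
      rintro rfl
      have := hQ.hasValue.unique hQ'.hasValue
      exact H.ne_neg hi0 (OnePoint.coe_injective this)
    obtain ⟨h1, h2, h3⟩ := H.liesOver_even (k := 2 ^ r) (j := r + 1) r.le_succ (P := P)
      (by rw [hset]; exact Set.toFinite _) (by
        intro R hR
        rw [← pow_succ']
        rcases (hover R).1 hR with rfl | rfl
        exacts [hQ.hasOrd_sq H hi, hQ'.hasOrd_sq H hi'])
    refine ⟨h1, ?_, h3⟩
    rw [hset, finsum_mem_pair hne, hQ.degree, hQ'.degree] at h2
    simpa using h2
  | succ k ih =>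
    obtain ⟨h1, h2, h3⟩ := ih
    have hu : ∀ R : Place K (towerField K x (r + 2 + k)), R.LiesOver P →
        R.HasOrd (towerSq K x (r + 2 + k)) (-2 ^ (r - k)) := by
      intro R hR
      have h4 := (h3 R hR).2.rec_of_ne_zero H.two_ne (by split_ifs <;> simp)
      have h5 : -|(if k = 0 then 2 ^ r else -2 ^ (r - k) : ℤ)| = -2 ^ (r - k) := by
        split_ifs with hk <;> simp [hk]
      rw [h5] at h4
      exact h4
    -- The order `-2 ^ (r - k)` of `u` is even exactly for `k < r`; from `k = r` on it is -1.
    rcases lt_or_ge k r with hk | hk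
    · obtain ⟨h4, h5, h6⟩ := H.liesOver_even (k := -2 ^ (r - (k + 1))) (by omega) h1 (by
        intro R hR
        convert hu R hR using 1
        rw [show r - k = r - (k + 1) + 1 by omega, pow_succ]; ring)
      refine ⟨h4, ?_, ?_⟩
      · refine h5.trans ?_
        rw [h2, min_eq_left hk.le, min_eq_left hk]; ring
      · rw [if_pos (Nat.succ_le_of_lt hk), if_neg k.succ_ne_zero]
        exact h6
    · obtain ⟨h4, h5, h6⟩ := H.liesOver_odd (k := -1) (by omega) h1 (by
        intro R hR
        convert hu R hR using 1
        rw [Nat.sub_eq_zero_of_le hk]; rfl)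
      refine ⟨h4, ?_, ?_⟩
      · refine h5.trans ?_
        rw [h2, min_eq_right hk, min_eq_right (hk.trans k.le_succ)]
      · have h7 : (-2 ^ (r - (k + 1)) : ℤ) = 2 * -1 + 1 := by
          rw [Nat.sub_eq_zero_of_le (hk.trans k.le_succ)]; rfl
        rw [if_neg (Nat.not_le.2 (Nat.lt_succ_of_le hk)), if_neg k.succ_ne_zero, h7]
        exact h6

end IsTower

/-! ### The named places and the list of all places over the special values -/

/-- The places `P^j_a` and `Q^j_b` of the tower, with the properties that determine them. -/
structure TowerPlaces (x : ℕ → L) (i : K) (P : (j : ℕ) → OnePoint K → Place K (towerField K x j))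
    (Q : (j : ℕ) → K → Place K (towerField K x j)) : Prop where
  isTower : IsTower K x
  sq : i ^ 2 = -1
  total : ∀ j, ∀ a ∈ totalValues i, ∀ S : Place K (towerField K x j),
    S.HasValue (IsTower.base K x j) a ↔ S = P j a
  totalOrd : ∀ j, ∀ a ∈ totalValues i, (P j a).HasOrd (towerSq K x j) (IsTower.totalOrd i j a)
  simple : ∀ j, ∀ b ∈ ({1, -1} : Set K), IsSimplePlace b (P j (b : OnePoint K))
  simple' : ∀ j, ∀ b ∈ ({i, -i} : Set K), IsSimplePlace b (Q j b)

theorem sq_ne_one (h2 : (2 : K) ≠ 0) {b : K} (hb : b ^ 2 = -1) :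
    b ^ 2 ≠ 1 := by
  intro h
  apply h2
  linear_combination hb - h

theorem coe_mem_totalValues {i b : K} (hi : i ^ 2 = -1)
    (h : (b : OnePoint K) ∈ totalValues i) : b = 0 ∨ b ^ 2 = -1 := by
  rcases h with h | h | h | h
  · exact absurd h (OnePoint.coe_ne_infty b)
  · exact Or.inl (OnePoint.coe_injective h)
  · rw [OnePoint.coe_injective h]; exact Or.inr hi
  · rw [OnePoint.coe_injective h, neg_sq]; exact Or.inr hi

theorem sq_of_mem {c b : K} (h : b ∈ ({c, -c} : Set K)) : b ^ 2 = c ^ 2 := by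
  rcases h with rfl | rfl
  · rfl
  · rw [neg_sq]

theorem IsTower.not_mem_totalValues (H : IsTower K x) {i b : K} (hi : i ^ 2 = -1)
    (hb : b ∈ ({1, -1} : Set K)) : (b : OnePoint K) ∉ totalValues i := by
  intro h
  have h1 := sq_of_mem hb
  rw [one_pow] at h1
  rcases coe_mem_totalValues hi h with rfl | h
  · simp at h1
  · exact sq_ne_one H.two_ne h h1

theorem IsTower.exists_places (H : IsTower K x) {i : K} (hi : i ^ 2 = -1) :
    ∃ P Q, TowerPlaces x i P Q := by
  -- One function of `a` has to serve two characterizations, by `x_0` for the totally ramified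
  -- values and by `x_j` for 1 and -1. They do not conflict, since these sets of values are
  -- disjoint; at all other `a` an arbitrary place is taken.
  have hP : ∀ j a, ∃ P : Place K (towerField K x j), (a ∈ totalValues i →
      (∀ S : Place K (towerField K x j), S.HasValue (IsTower.base K x j) a ↔ S = P) ∧
      P.HasOrd (towerSq K x j) (IsTower.totalOrd i j a)) ∧
      ∀ b ∈ ({1, -1} : Set K), a = b → IsSimplePlace b P := by
    intro j a
    by_cases ha : a ∈ totalValues i
    · obtain ⟨P, hP⟩ := H.exists_total hi j ha
      exact ⟨P, fun _ => hP, fun b hb hab => absurd (hab ▸ ha) (H.not_mem_totalValues hi hb)⟩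
    by_cases hb : ∃ b ∈ ({1, -1} : Set K), a = b
    · obtain ⟨b, hb, rfl⟩ := hb
      obtain ⟨P, hP⟩ := H.exists_isSimplePlace_one (j := j) (c := b)
        (by rw [sq_of_mem hb, one_pow])
      exact ⟨P, fun h => absurd h ha, fun c _ hbc => OnePoint.coe_injective hbc ▸ hP⟩
    · obtain ⟨P, -⟩ := H.exists_pole j
      exact ⟨P, fun h => absurd h ha, fun b h1 h2 => absurd ⟨b, h1, h2⟩ hb⟩
  have hQ : ∀ j b, ∃ Q : Place K (towerField K x j), b ∈ ({i, -i} : Set K) →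
      IsSimplePlace b Q := by
    intro j b
    by_cases hb : b ∈ ({i, -i} : Set K)
    · obtain ⟨Q, hQ⟩ := H.exists_isSimplePlace (j := j) (c := b)
        (by linear_combination (b ^ 2 - 1) * (sq_of_mem hb).trans hi)
      exact ⟨Q, fun _ => hQ⟩
    · obtain ⟨P, -⟩ := H.exists_pole j
      exact ⟨P, fun h => absurd h hb⟩
  choose P hP using hP
  choose Q hQ using hQ
  exact ⟨P, Q, H, hi, fun j a ha => ((hP j a).1 ha).1, fun j a ha => ((hP j a).1 ha).2,
    fun j b hb => (hP j b).2 b hb rfl, hQ⟩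

namespace TowerPlaces

variable {i : K} {P : (j : ℕ) → OnePoint K → Place K (towerField K x j)}
  {Q : (j : ℕ) → K → Place K (towerField K x j)} {j r : ℕ}

theorem ne_zero (D : TowerPlaces x i P Q) : i ≠ 0 := by
  rintro rfl
  simpa using D.sq

theorem simple_one (D : TowerPlaces x i P Q) (j : ℕ) :
    IsSimplePlace 1 (P j ((1 : K) : OnePoint K)) := D.simple j 1 (by simp)

theorem simple_neg_one (D : TowerPlaces x i P Q) (j : ℕ) :
    IsSimplePlace (-1) (P j ((-1 : K) : OnePoint K)) := D.simple j (-1) (by simp)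

theorem zero_hasValue_iff (D : TowerPlaces x i P Q) {a : OnePoint K} (ha : a ∈ specialValues i)
    (S : Place K (towerField K x 0)) : S.HasValue (towerGen K x 0) a ↔ S = P 0 a := by
  rcases ha with ha | rfl | rfl
  · rw [← D.total 0 a ha, IsTower.base_zero]
  · exact (D.simple_one 0).hasValue_iff S
  · exact (D.simple_neg_one 0).hasValue_iff S

theorem liesOver_zero_iff (D : TowerPlaces x i P Q) {a : OnePoint K} (ha : a ∈ specialValues i)
    (S : Place K (towerField K x j)) : S.LiesOver (P 0 a) ↔ S.HasValue (IsTower.base K x j) a := by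
  obtain ⟨R, hR⟩ := D.isTower.exists_restrict j.zero_le S
  rw [hR.hasValue, D.zero_hasValue_iff ha]
  constructor
  · exact fun h => hR.unique (h.over j.zero_le)
  · rintro rfl
    exact (liesOver_iff _).2 hR

theorem total_iff (D : TowerPlaces x i P Q) {a : OnePoint K} (ha : a ∈ totalValues i)
    (S : Place K (towerField K x j)) : S.LiesOver (P 0 a) ↔ S = P j a := by
  rw [D.liesOver_zero_iff (Or.inl ha), D.total j a ha]

theorem totalOrd_eq_or (i : K) (j : ℕ) (a : OnePoint K) :
    ∃ k, IsTower.totalOrd i j a = 2 * k + 1 := by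
  rw [IsTower.totalOrd]
  split_ifs
  · exact ⟨0, rfl⟩
  · exact ⟨-1, rfl⟩

theorem total_over (D : TowerPlaces x i P Q) {a : OnePoint K} (ha : a ∈ totalValues i) :
    Over (towerIncl K x j.le_succ) (P (j + 1) a) (P j a) := by
  obtain ⟨R, hR⟩ := D.isTower.exists_restrict_succ (P (j + 1) a)
  have h := (D.total (j + 1) a ha (P (j + 1) a)).2 rfl
  rw [IsTower.hasValue_base hR, D.total j a ha] at h
  rwa [← h]

theorem total_succ (D : TowerPlaces x i P Q) {a : OnePoint K} (ha : a ∈ totalValues i) :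
    (P (j + 1) a).HasRamificationIndex (P j a) 2 ∧
      (P (j + 1) a).HasOrd (towerGen K x (j + 1)) (IsTower.totalOrd i j a) := by
  have h := D.totalOrd j a ha
  obtain ⟨k, hk⟩ := totalOrd_eq_or i j a
  rw [hk] at h ⊢
  have hover := D.total_over ha (j := j)
  obtain ⟨-, h1, h2⟩ := (D.isTower.isQuadratic j).isDiscrete_of_odd (D.isTower.isDiscrete _) h hover
  exact ⟨hasRamificationIndex_of _ (D.isTower.isDiscrete _) hover h2, h1⟩

theorem infty_hasOrd (D : TowerPlaces x i P Q) (j : ℕ) :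
    (P j ∞).HasOrd (towerGen K x j) (-1) := by
  have hmem : (∞ : OnePoint K) ∈ totalValues i := by simp [totalValues]
  rcases j with _ | j
  · obtain ⟨R, h1, -, h2⟩ := D.isTower.exists_place_zero ∞
    rw [(h1 _).1 ((D.zero_hasValue_iff (Or.inl hmem) _).2 rfl)]
    have h3 : R.HasOrd (towerGen K x 0)⁻¹⁻¹ (-1) := h2.inv
    rwa [inv_inv] at h3
  · have := (D.total_succ hmem (j := j)).2
    rwa [IsTower.totalOrd, if_neg (by simp)] at this

theorem zero_hasOrd (D : TowerPlaces x i P Q) (j : ℕ) :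
    (P j ((0 : K) : OnePoint K)).HasOrd (towerGen K x j) (if j = 0 then 1 else -1) := by
  have h0 : ((0 : K) : OnePoint K) ∈ totalValues i := by simp [totalValues]
  rcases j with _ | j
  · obtain ⟨R, h1, h2, h3⟩ := D.isTower.exists_isSimplePlace_zero (0 : K)
    rw [(h1 _).1 ((D.zero_hasValue_iff (Or.inl h0) _).2 rfl)]
    simpa using h2
  · have := (D.total_succ h0 (j := j)).2
    rwa [IsTower.totalOrd, if_neg (by simp [D.ne_zero, D.ne_zero.symm])] at this

theorem mem_totalValues (b : K) (hb : b ∈ ({i, -i} : Set K)) :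
    (b : OnePoint K) ∈ totalValues i := by
  rcases hb with rfl | rfl <;> simp [totalValues]

theorem imag_hasOrd (D : TowerPlaces x i P Q) (j : ℕ) {b : K} (hb : b ∈ ({i, -i} : Set K)) :
    (P j (b : OnePoint K)).HasOrd (towerGen K x j)
        (if j = 0 then 0 else if j = 1 then 1 else -1) := by
  have hbt := mem_totalValues b hb
  rcases j with _ | j
  · refine (D.isTower.isDiscrete _).hasOrd_zero ?_
    have hb0 : b ≠ 0 := by
      rintro rfl
      have := sq_of_mem hb
      rw [D.sq] at this
      simp at this
    exact HasValue.val_eq_one ((D.zero_hasValue_iff (Or.inl hbt) _).2 rfl) hb0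
  · have := (D.total_succ hbt (j := j)).2
    rw [if_neg j.succ_ne_zero]
    rcases j with _ | j
    · rwa [IsTower.totalOrd, if_pos] at this
      refine ⟨rfl, ?_⟩
      rcases hb with rfl | rfl <;> simp
    · rwa [IsTower.totalOrd, if_neg (by simp)] at this

theorem simple_over (D : TowerPlaces x i P Q) {b : K} (hb : b ∈ ({1, -1} : Set K)) (j : ℕ) :
    Over (towerIncl K x j.le_succ) (P (j + 1) (b : OnePoint K)) (P j ((1 : K) : OnePoint K)) := by
  have hb2 : b ^ 2 = 1 := by rw [sq_of_mem hb, one_pow]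
  exact IsSimplePlace.over_of_hasValue D.isTower (by linear_combination (b ^ 2 + 1) * hb2)
    (by rw [hb2]; exact D.simple_one j) (D.simple _ b hb).hasValue

theorem simple_ramification (D : TowerPlaces x i P Q) {b : K} (hb : b ∈ ({1, -1} : Set K))
    (j : ℕ) :
    (P (j + 1) (b : OnePoint K)).HasRamificationIndex (P j ((1 : K) : OnePoint K)) 1 := by
  have hb2 : b ^ 2 = 1 := by rw [sq_of_mem hb, one_pow]
  exact IsSimplePlace.hasRamificationIndex D.isTower
    (by linear_combination (b ^ 2 + 1) * hb2) (by rw [hb2]; exact D.simple_one j) (D.simple_over hb j)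

theorem imag_over (D : TowerPlaces x i P Q) {b : K} (hb : b ∈ ({i, -i} : Set K)) (j : ℕ) :
    Over (towerIncl K x j.le_succ) (Q (j + 1) b) (P j ((-1 : K) : OnePoint K)) := by
  have hb2 : b ^ 2 = -1 := (sq_of_mem hb).trans D.sq
  exact IsSimplePlace.over_of_hasValue D.isTower (by linear_combination (b ^ 2 - 1) * hb2)
    (by rw [hb2]; exact D.simple_neg_one j) (D.simple' _ b hb).hasValue

theorem imag_ramification (D : TowerPlaces x i P Q) {b : K} (hb : b ∈ ({i, -i} : Set K))
    (j : ℕ) :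
    (Q (j + 1) b).HasRamificationIndex (P j ((-1 : K) : OnePoint K)) 1 := by
  have hb2 : b ^ 2 = -1 := (sq_of_mem hb).trans D.sq
  exact IsSimplePlace.hasRamificationIndex D.isTower
    (by linear_combination (b ^ 2 - 1) * hb2) (by rw [hb2]; exact D.simple_neg_one j) (D.imag_over hb j)

theorem liesOver_succ_iff (D : TowerPlaces x i P Q) (S : Place K (towerField K x (j + 1))) :
    S.LiesOver (P j ((-1 : K) : OnePoint K)) ↔ S = Q (j + 1) i ∨ S = Q (j + 1) (-i) :=
  D.isTower.liesOver_base D.sq (D.simple_neg_one j) (D.simple' _ i (by simp))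
    (D.simple' _ (-i) (by simp)) S

/-- For `r < j`, the places `P^j_1` and `P^j_{-1}` lie over `P^r_1`. -/
theorem simple_over_one (D : TowerPlaces x i P Q) {b : K} (hb : b ∈ ({1, -1} : Set K))
    (h : r < j) : (P j (b : OnePoint K)).LiesOver (P r ((1 : K) : OnePoint K)) := by
  induction j, h using Nat.le_induction generalizing b with
  | base => exact (liesOver_iff r.le_succ).2 (D.simple_over hb r)
  | succ j h ih =>
    have hrj : r ≤ j := (Nat.le_succ r).trans h
    have h1 := (ih (b := 1) (by simp)).over hrj
    exact (liesOver_iff _).2 (over_trans (D.simple_over hb j) h1)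

theorem exists_base (D : TowerPlaces x i P Q) {b : K} (hb : b ∈ ({1, -1} : Set K)) (j : ℕ) :
    ∃ c ∈ ({1, -1} : Set K), (P j (b : OnePoint K)).LiesOver (P 0 (c : OnePoint K)) := by
  rcases j with _ | j
  · exact ⟨b, hb, (liesOver_iff le_rfl).2 (over_self _ _)⟩
  · exact ⟨1, by simp, D.simple_over_one hb j.succ_pos⟩

theorem mem_specialValues (b : K) (hb : b ∈ ({1, -1} : Set K)) :
    (b : OnePoint K) ∈ specialValues i := by
  rcases hb with rfl | rfl <;> simp [specialValues]

theorem liesOver_trans {q : ℕ} (hqr : q ≤ r) (hrj : r ≤ j) {S : Place K (towerField K x j)}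
    {R : Place K (towerField K x r)} {T : Place K (towerField K x q)} (hS : S.LiesOver R)
    (hR : R.LiesOver T) : S.LiesOver T :=
  (liesOver_iff _).2 (over_trans (hS.over hrj) (hR.over hqr))

theorem exists_base_of_liesOver (D : TowerPlaces x i P Q) (h : r ≤ j)
    {S : Place K (towerField K x j)} (hS : S.LiesOver (P r ((-1 : K) : OnePoint K))) :
    ∃ c ∈ ({1, -1} : Set K), S.LiesOver (P 0 (c : OnePoint K)) := by
  obtain ⟨c, hc, h1⟩ := D.exists_base (b := -1) (by simp) r
  exact ⟨c, hc, liesOver_trans r.zero_le h hS h1⟩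

/-- While `x_j` has value 1, the next value is 1 or -1. Either the values of `x` stay in this range
up to level `j`, or the value -1 has been left at some level `r < j`, and then the place lies over
`P^r_{-1}`. -/
theorem eq_or_liesOver (D : TowerPlaces x i P Q) {S : Place K (towerField K x j)} {b : K}
    (hb : b ∈ ({1, -1} : Set K)) (hS : S.LiesOver (P 0 (b : OnePoint K))) :
    (∃ c ∈ ({1, -1} : Set K), S = P j (c : OnePoint K)) ∨
      ∃ r < j, S.LiesOver (P r ((-1 : K) : OnePoint K)) := by
  induction j with
  | zero => exact Or.inl ⟨b, hb, (hS.over le_rfl).unique (over_self _ S) |>.symm⟩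
  | succ j ih =>
    obtain ⟨R, hR⟩ := D.isTower.exists_restrict_succ S
    have hR0 : R.LiesOver (P 0 (b : OnePoint K)) :=
      (liesOver_iff j.zero_le).2 (over_of_over hR (hS.over (j + 1).zero_le))
    rcases ih hR0 with ⟨c, rfl | rfl, h⟩ | ⟨r, hr, h⟩
    · left
      have h1 := (D.isTower.hasValue_sq_iff (c := 1) (one_pow 4) hR).2
        (by rw [h, one_pow]; exact (D.simple_one j).hasValue)
      rcases h1 with h1 | h1
      · exact ⟨1, by simp, ((D.simple_one _).hasValue_iff S).1 h1⟩
      · exact ⟨-1, by simp, ((D.simple_neg_one _).hasValue_iff S).1 h1⟩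
    · right
      exact ⟨j, j.lt_succ_self, (liesOver_iff j.le_succ).2 (h ▸ hR)⟩
    · right
      refine ⟨r, hr.trans j.lt_succ_self, ?_⟩
      exact liesOver_trans hr.le j.le_succ ((liesOver_iff _).2 hR) h

theorem list_iff (D : TowerPlaces x i P Q) (S : Place K (towerField K x j)) :
    (∃ a ∈ specialValues i, S.LiesOver (P 0 a)) ↔
      (∃ a ∈ specialValues i, S = P j a) ∨
      (∃ r : ℕ, r + 2 ≤ j ∧ S.LiesOver (P r ((-1 : K) : OnePoint K))) ∨
      (∃ b ∈ ({i, -i} : Set K), S = Q j b) := by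
  have hspec : ∀ {b : K}, b ∈ ({1, -1} : Set K) → S.LiesOver (P 0 (b : OnePoint K)) →
      ∃ a ∈ specialValues i, S.LiesOver (P 0 a) := fun hb h => ⟨_, mem_specialValues _ hb, h⟩
  constructor
  · rintro ⟨a, ha, hS⟩
    have key : ∀ b ∈ ({1, -1} : Set K), a = b → (∃ a ∈ specialValues i, S = P j a) ∨
        (∃ r : ℕ, r + 2 ≤ j ∧ S.LiesOver (P r ((-1 : K) : OnePoint K))) ∨
        (∃ b ∈ ({i, -i} : Set K), S = Q j b) := by
      rintro b hb rfl
      rcases D.eq_or_liesOver hb hS with ⟨c, hc, rfl⟩ | ⟨r, hr, h⟩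
      · exact Or.inl ⟨_, mem_specialValues c hc, rfl⟩
      · right
        rcases Nat.lt_or_ge j (r + 2) with hj | hj
        · right
          -- The case `r = j - 1` is excluded from the middle family of the list; its places are the
          -- two places `Q`.
          obtain rfl : j = r + 1 := by omega
          rcases (D.liesOver_succ_iff S).1 h with rfl | rfl
          exacts [⟨i, by simp, rfl⟩, ⟨-i, by simp, rfl⟩]
        · exact Or.inl ⟨r, hj, h⟩
    rcases ha with ha | rfl | rfl
    · exact Or.inl ⟨a, Or.inl ha, (D.total_iff ha S).1 hS⟩
    · exact key 1 (by simp) rfl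
    · exact key (-1) (by simp) rfl
  · rintro (⟨a, ha, rfl⟩ | ⟨r, hr, h⟩ | ⟨b, hb, rfl⟩)
    · have key : ∀ b ∈ ({1, -1} : Set K), a = b →
          ∃ c ∈ specialValues i, (P j a).LiesOver (P 0 c) := by
        rintro b hb rfl
        obtain ⟨c, hc, h⟩ := D.exists_base hb j
        exact ⟨c, mem_specialValues c hc, h⟩
      rcases ha with ha | rfl | rfl
      · exact ⟨a, Or.inl ha, (D.total_iff ha _).2 rfl⟩
      · exact key 1 (by simp) rfl
      · exact key (-1) (by simp) rfl
    · obtain ⟨c, hc, h1⟩ := D.exists_base_of_liesOver (by omega) h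
      exact hspec hc h1
    · rcases j with _ | j
      · refine ⟨b, Or.inl (mem_totalValues b hb), (liesOver_iff le_rfl).2 ?_⟩
        rw [← (D.zero_hasValue_iff (Or.inl (mem_totalValues b hb)) _).1 (D.simple' 0 b hb).hasValue]
        exact over_self _ _
      · obtain ⟨c, hc, h1⟩ := D.exists_base_of_liesOver j.le_succ
          ((liesOver_iff j.le_succ).2 (D.imag_over hb j))
        exact hspec hc h1

theorem one_ne_neg_one (D : TowerPlaces x i P Q) : (1 : K) ≠ -1 :=
  D.isTower.ne_neg one_ne_zero

theorem simple_ne (D : TowerPlaces x i P Q) (j : ℕ) :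
    P j ((1 : K) : OnePoint K) ≠ P j ((-1 : K) : OnePoint K) := by
  intro h
  have h1 := (D.simple_one j).hasValue
  rw [h] at h1
  exact D.one_ne_neg_one (OnePoint.coe_injective (h1.unique (D.simple_neg_one j).hasValue))

theorem not_liesOver_total (D : TowerPlaces x i P Q) {a : OnePoint K} (ha : a ∈ totalValues i)
    {b : K} (hb : b ∈ ({1, -1} : Set K)) : ¬ (P j a).LiesOver (P 0 (b : OnePoint K)) := by
  intro h
  have h1 := (D.liesOver_zero_iff (mem_specialValues b hb) _).1 h
  have h2 := (D.total j a ha _).2 rfl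
  exact D.isTower.not_mem_totalValues D.sq hb (h2.unique h1 ▸ ha)

theorem total_ne_simple (D : TowerPlaces x i P Q) {a : OnePoint K} (ha : a ∈ totalValues i)
    {b : K} (hb : b ∈ ({1, -1} : Set K)) : P j a ≠ P j (b : OnePoint K) := by
  intro h
  obtain ⟨c, hc, h1⟩ := D.exists_base hb j
  exact D.not_liesOver_total ha hc (h ▸ h1)

theorem injOn (D : TowerPlaces x i P Q) (j : ℕ) : Set.InjOn (P j) (specialValues i) := by
  have h1 : (1 : K) ∈ ({1, -1} : Set K) := by simp
  have h2 : (-1 : K) ∈ ({1, -1} : Set K) := by simp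
  rintro a (ha | rfl | rfl) a' (ha' | rfl | rfl) h
  · have h3 := (D.total j a ha _).2 rfl
    rw [h] at h3
    exact h3.unique ((D.total j a' ha' _).2 rfl)
  · exact absurd h (D.total_ne_simple ha h1)
  · exact absurd h (D.total_ne_simple ha h2)
  · exact absurd h.symm (D.total_ne_simple ha' h1)
  · rfl
  · exact absurd h (D.simple_ne j)
  · exact absurd h.symm (D.total_ne_simple ha' h2)
  · exact absurd h.symm (D.simple_ne j)
  · rfl

theorem imag_ne (D : TowerPlaces x i P Q) (j : ℕ) : Q j i ≠ Q j (-i) := by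
  intro h
  have h1 := (D.simple' j i (by simp)).hasValue
  rw [h] at h1
  exact D.isTower.ne_neg D.ne_zero
    (OnePoint.coe_injective (h1.unique (D.simple' j (-i) (by simp)).hasValue))

theorem imag_ne_simple (D : TowerPlaces x i P Q) {b c : K} (hb : b ∈ ({i, -i} : Set K))
    (hc : c ∈ ({1, -1} : Set K)) : Q j b ≠ P j (c : OnePoint K) := by
  intro h
  have h1 := (D.simple' j b hb).hasValue
  rw [h] at h1
  have h2 := OnePoint.coe_injective (h1.unique (D.simple j c hc).hasValue)
  refine sq_ne_one D.isTower.two_ne ((sq_of_mem hb).trans D.sq) ?_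
  rw [h2, sq_of_mem hc, one_pow]

theorem imag_eq_iff (D : TowerPlaces x i P Q) {b : K} (hb : b ∈ ({i, -i} : Set K))
    {a : OnePoint K} (ha : a ∈ specialValues i) :
    Q j b = P j a ↔ j = 0 ∧ a = (b : OnePoint K) := by
  constructor
  · intro h
    rcases ha with ha | rfl | rfl
    · rcases j with _ | j
      · refine ⟨rfl, HasValue.unique (P := P 0 a) (g := towerGen K x 0) ?_ ?_⟩
        · exact (D.zero_hasValue_iff (Or.inl ha) _).2 rfl
        · rw [← h]; exact (D.simple' 0 b hb).hasValue
      · obtain ⟨c, hc, h1⟩ := D.exists_base_of_liesOver j.le_succ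
          ((liesOver_iff j.le_succ).2 (D.imag_over hb j))
        exact absurd (h ▸ h1) (D.not_liesOver_total ha hc)
    · exact absurd h (D.imag_ne_simple hb (by simp))
    · exact absurd h (D.imag_ne_simple hb (by simp))
  · rintro ⟨rfl, rfl⟩
    exact (D.zero_hasValue_iff ha _).1 (D.simple' 0 b hb).hasValue

/-- For `r < s` the place `P^s_{-1}` lies over `P^r_1`, which differs from `P^r_{-1}`. -/
theorem liesOver_unique (D : TowerPlaces x i P Q) {s : ℕ} (hrj : r ≤ j) (hsj : s ≤ j)
    {S : Place K (towerField K x j)} (hr : S.LiesOver (P r ((-1 : K) : OnePoint K)))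
    (hs : S.LiesOver (P s ((-1 : K) : OnePoint K))) : s = r := by
  wlog h : r < s generalizing r s
  · rcases (not_lt.1 h).lt_or_eq with h | h
    · exact (this hsj hrj hs hr h).symm
    · exact h
  exfalso
  have h1 := liesOver_trans h.le hsj hs (D.simple_over_one (b := -1) (by simp) h)
  exact D.simple_ne r ((h1.over hrj).unique (hr.over hrj))

theorem liesOver_ne (D : TowerPlaces x i P Q) (hr : r + 2 ≤ j) {S : Place K (towerField K x j)}
    (hS : S.LiesOver (P r ((-1 : K) : OnePoint K))) :
    (∀ a ∈ specialValues i, S ≠ P j a) ∧ ∀ b ∈ ({i, -i} : Set K), S ≠ Q j b := by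
  have hrj : r < j := by omega
  have key : ∀ b ∈ ({1, -1} : Set K), S ≠ P j (b : OnePoint K) := by
    rintro b hb rfl
    exact D.simple_ne r (((D.simple_over_one hb hrj).over hrj.le).unique (hS.over hrj.le))
  refine ⟨?_, ?_⟩
  · rintro a (ha | rfl | rfl)
    · rintro rfl
      obtain ⟨c, hc, h1⟩ := D.exists_base_of_liesOver hrj.le hS
      exact D.not_liesOver_total ha hc h1
    · exact key 1 (by simp)
    · exact key (-1) (by simp)
  · rintro b hb rfl
    obtain ⟨j, rfl⟩ : ∃ k, j = k + 1 := ⟨j - 1, by omega⟩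
    -- A place `Q` on level `j + 1` lies over `P^j_{-1}`, so `r` would equal `j`, against `r + 2 ≤ j
    -- + 1`.
    have := D.liesOver_unique hrj.le j.le_succ hS ((liesOver_iff j.le_succ).2 (D.imag_over hb j))
    omega

/-- Backwards along the recursion, `∞` comes from 0 or `∞`, 0 from `±i`, `±i` from -1, and `±1` from
1. A special value of `x_j` therefore forces a special value of `x_0`. -/
theorem hasValue_special (D : TowerPlaces x i P Q) (S : Place K (towerField K x j))
    (h : ∃ a ∈ specialValues i, S.HasValue (towerGen K x j) a) :
    ∃ a ∈ specialValues i, S.LiesOver (P 0 a) := by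
  induction j with
  | zero =>
    obtain ⟨a, ha, h⟩ := h
    refine ⟨a, ha, (liesOver_iff le_rfl).2 ?_⟩
    rw [← (D.zero_hasValue_iff ha S).1 h]
    exact over_self _ _
  | succ j ih =>
    obtain ⟨R, hR⟩ := D.isTower.exists_restrict_succ S
    suffices h' : ∃ a ∈ specialValues i, R.HasValue (towerGen K x j) a by
      obtain ⟨a, ha, h1⟩ := ih R h'
      exact ⟨a, ha, liesOver_trans j.zero_le j.le_succ ((liesOver_iff _).2 hR) h1⟩
    have hi4 : i ^ 4 = 1 := by linear_combination (i ^ 2 - 1) * D.sq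
    obtain ⟨a, (rfl | rfl | rfl | rfl) | rfl | rfl, h⟩ := h
    · rcases (D.isTower.hasValue_infty_iff hR).1 h with h1 | h1
      exacts [⟨_, by simp [specialValues, totalValues], h1⟩,
        ⟨_, by simp [specialValues, totalValues], h1⟩]
    · rcases (D.isTower.hasValue_zero_iff D.sq hR).1 h with h1 | h1
      exacts [⟨_, by simp [specialValues, totalValues], h1⟩,
        ⟨_, by simp [specialValues, totalValues], h1⟩]
    · have h1 := (D.isTower.hasValue_sq_iff hi4 hR).1 (Or.inl h)
      rw [D.sq] at h1
      exact ⟨_, by simp [specialValues, totalValues], h1⟩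
    · have h1 := (D.isTower.hasValue_sq_iff hi4 hR).1 (Or.inr h)
      rw [D.sq] at h1
      exact ⟨_, by simp [specialValues, totalValues], h1⟩
    · have h1 := (D.isTower.hasValue_sq_iff (one_pow 4) hR).1 (Or.inl h)
      rw [one_pow] at h1
      exact ⟨_, by simp [specialValues, totalValues], h1⟩
    · have h1 := (D.isTower.hasValue_sq_iff (one_pow 4) hR).1 (Or.inr h)
      rw [one_pow] at h1
      exact ⟨_, by simp [specialValues, totalValues], h1⟩

theorem hasOrd_zero (D : TowerPlaces x i P Q) (S : Place K (towerField K x j))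
    (h : ∀ a ∈ specialValues i, ¬ S.LiesOver (P 0 a)) : S.HasOrd (towerGen K x j) 0 := by
  refine (D.isTower.isDiscrete S).hasOrd_zero ?_
  by_contra h1
  have : ∃ a ∈ specialValues i, S.HasValue (towerGen K x j) a := by
    rcases val_ne_one_iff.1 h1 with h2 | h2
    exacts [⟨_, by simp [specialValues, totalValues], h2⟩,
      ⟨_, by simp [specialValues, totalValues], h2⟩]
  obtain ⟨a, ha, h2⟩ := D.hasValue_special S this
  exact h a ha h2

end TowerPlaces

theorem two_ne_zero_of_natCard {p : ℕ} (hp : p.Prime) (hp2 : p ≠ 2) (hK : Nat.card K = p ^ 2) :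
    (2 : K) ≠ 0 := by
  intro h
  have h1 : addOrderOf (1 : K) ∣ 2 := by
    rw [addOrderOf_dvd_iff_nsmul_eq_zero]
    simpa using h
  have h2 : addOrderOf (1 : K) ∣ p ^ 2 := hK ▸ addOrderOf_dvd_natCard (1 : K)
  have hcop : Nat.Coprime 2 (p ^ 2) :=
    Nat.Coprime.pow_right 2 ((Nat.coprime_primes Nat.prime_two hp).2 hp2.symm)
  have h3 := Nat.eq_one_of_dvd_coprimes hcop h1 h2
  rw [AddMonoid.addOrderOf_eq_one_iff] at h3
  exact one_ne_zero h3

end Tower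

/-! ### The theorem -/

theorem mainTheorem6 (p : ℕ) (hp : p.Prime) (hp2 : p ≠ 2)
    {K : Type*} [Field K] (hK : Nat.card K = p ^ 2) (i : K) (hi : i ^ 2 = -1)
    {L : Type*} [Field L] [Algebra K L] (x : ℕ → L) (hx0 : Transcendental K (x 0))
    (hx : ∀ j, x (j + 1) ^ 2 = (x j ^ 2 + 1) / (2 * x j)) :
    -- `P j a` is the place `P^j_a` and `Q j b` is the place `Q^j_b` of `T_j`
    ∃ (P : (j : ℕ) → OnePoint K → Place K (towerField K x j))
      (Q : (j : ℕ) → K → Place K (towerField K x j)),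
      -- the places in `R`
      (∀ a ∈ specialValues i, ∀ S : Place K (towerField K x 0),
        S.HasValue (towerGen K x 0) a ↔ S = P 0 a) ∧
      -- (a)
      (∀ j, ∀ a ∈ totalValues i, ∀ S : Place K (towerField K x j),
        S.LiesOver (P 0 a) ↔ S = P j a) ∧
      (∀ j, 1 ≤ j → ∀ a ∈ totalValues i, (P j a).HasRamificationIndex (P (j - 1) a) 2) ∧
      (∀ j, (P j ∞).HasOrd (towerGen K x j) (-1)) ∧
      (∀ j, (P j ((0 : K) : OnePoint K)).HasOrd (towerGen K x j) (if j = 0 then 1 else -1)) ∧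
      (∀ j, ∀ b ∈ ({i, -i} : Set K), (P j (b : OnePoint K)).HasOrd (towerGen K x j)
        (if j = 0 then 0 else if j = 1 then 1 else -1)) ∧
      -- (b)
      (∀ j, ∀ b ∈ ({1, -1} : Set K),
        (∀ S : Place K (towerField K x j),
          S.HasValue (towerGen K x j) (b : OnePoint K) ↔ S = P j (b : OnePoint K)) ∧
        (1 ≤ j → (P j (b : OnePoint K)).LiesOver (P (j - 1) ((1 : K) : OnePoint K)) ∧
          (P j (b : OnePoint K)).HasRamificationIndex (P (j - 1) ((1 : K) : OnePoint K)) 1)) ∧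
      -- (c), where `/` is the integer division that rounds down
      (∀ j r : ℕ, (r : ℤ) ≤ ((j : ℤ) - 3) / 2 →
        3 ≤ j ∧ (r : ℤ) < (j : ℤ) - 1 ∧
        {S : Place K (towerField K x j) | S.LiesOver (P r ((-1 : K) : OnePoint K))}.Finite ∧
        (∑ᶠ S ∈ {S : Place K (towerField K x j) | S.LiesOver (P r ((-1 : K) : OnePoint K))},
          S.degree) = 2 ^ (r + 2) ∧
        ∀ S : Place K (towerField K x j), S.LiesOver (P r ((-1 : K) : OnePoint K)) →
          (∃ S' : Place K (towerField K x (j - 1)),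
            S'.LiesOver (P r ((-1 : K) : OnePoint K)) ∧ S.HasRamificationIndex S' 2) ∧
          S.HasOrd (towerGen K x j) (-1)) ∧
      -- (d); here `j ≤ 2 * r + 2`, so the subtractions in the exponents are exact
      (∀ j r : ℕ, ((j : ℤ) - 1) / 2 ≤ (r : ℤ) → (r : ℤ) ≤ (j : ℤ) - 2 →
        2 ≤ j ∧
        {S : Place K (towerField K x j) | S.LiesOver (P r ((-1 : K) : OnePoint K))}.Finite ∧
        (∑ᶠ S ∈ {S : Place K (towerField K x j) | S.LiesOver (P r ((-1 : K) : OnePoint K))},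
          S.degree) = 2 ^ (j - r) ∧
        ∀ S : Place K (towerField K x j), S.LiesOver (P r ((-1 : K) : OnePoint K)) →
          (∃ S' : Place K (towerField K x (j - 1)),
            S'.LiesOver (P r ((-1 : K) : OnePoint K)) ∧ S.HasRamificationIndex S' 1) ∧
          S.HasOrd (towerGen K x j)
            (if (r : ℤ) ≤ (j : ℤ) - 3 then -(2 : ℤ) ^ (2 * r + 2 - j) else (2 : ℤ) ^ (j - 2))) ∧
      -- (e)
      (∀ j, ∀ b ∈ ({i, -i} : Set K),
        (∀ S : Place K (towerField K x j),
          S.HasValue (towerGen K x j) (b : OnePoint K) ↔ S = Q j b) ∧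
        (1 ≤ j → (Q j b).LiesOver (P (j - 1) ((-1 : K) : OnePoint K)) ∧
          (Q j b).HasRamificationIndex (P (j - 1) ((-1 : K) : OnePoint K)) 1)) ∧
      (∀ j, 1 ≤ j → ∀ S : Place K (towerField K x j),
        S.LiesOver (P (j - 1) ((-1 : K) : OnePoint K)) ↔ S = Q j i ∨ S = Q j (-i)) ∧
      -- (f): the list is complete
      (∀ j, ∀ S : Place K (towerField K x j),
        (∃ a ∈ specialValues i, S.LiesOver (P 0 a)) ↔
          (∃ a ∈ specialValues i, S = P j a) ∨
          (∃ r : ℕ, r + 2 ≤ j ∧ S.LiesOver (P r ((-1 : K) : OnePoint K))) ∨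
          (∃ b ∈ ({i, -i} : Set K), S = Q j b)) ∧
      -- (f): the places are distinct, with the exception `Q 0 b = P 0 b`
      (∀ j,
        Set.InjOn (P j) (specialValues i) ∧
        Q j i ≠ Q j (-i) ∧
        (∀ b ∈ ({i, -i} : Set K), ∀ a ∈ specialValues i,
          Q j b = P j a ↔ j = 0 ∧ a = (b : OnePoint K)) ∧
        ∀ r : ℕ, r + 2 ≤ j → ∀ S : Place K (towerField K x j),
          S.LiesOver (P r ((-1 : K) : OnePoint K)) →
          (∀ a ∈ specialValues i, S ≠ P j a) ∧
          (∀ b ∈ ({i, -i} : Set K), S ≠ Q j b) ∧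
          ∀ s : ℕ, s + 2 ≤ j → S.LiesOver (P s ((-1 : K) : OnePoint K)) → s = r) ∧
      -- (g)
      (∀ j, ∀ S : Place K (towerField K x j),
        (∀ a ∈ specialValues i, ¬ S.LiesOver (P 0 a)) → S.HasOrd (towerGen K x j) 0) ∧
      -- (h)
      (∀ j, ∀ b ∈ ({i, -i} : Set K), (Q j b).HasOrd (towerGen K x j ^ 2 + 1) (2 ^ j)) := by
  have H : IsTower K x := ⟨two_ne_zero_of_natCard hp hp2 hK, hx0, hx⟩
  obtain ⟨P, Q, D⟩ := H.exists_places hi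
  refine ⟨P, Q, fun a ha S => D.zero_hasValue_iff ha S, fun j a ha S => D.total_iff ha S, ?_,
    D.infty_hasOrd, D.zero_hasOrd, fun j b hb => D.imag_hasOrd j hb, ?_, ?_, ?_, ?_, ?_,
    fun j S => D.list_iff S, ?_, fun j S hS => D.hasOrd_zero S hS, ?_⟩
  · intro j hj a ha
    obtain ⟨j, rfl⟩ := Nat.exists_eq_add_of_le' hj
    exact (D.total_succ ha).1
  · refine fun j b hb => ⟨(D.simple j b hb).hasValue_iff, fun hj => ?_⟩
    obtain ⟨j, rfl⟩ := Nat.exists_eq_add_of_le' hj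
    exact ⟨(Place.liesOver_iff j.le_succ).2 (D.simple_over hb j), D.simple_ramification hb j⟩
  · intro j r hr
    -- With `k = j - r - 2` the hypothesis of (c) reads `k > r`; for `j < 3` the rounded quotient is
    -- negative and no `r` qualifies.
    obtain ⟨k, rfl⟩ : ∃ k, j = r + 2 + k := ⟨j - (r + 2), by omega⟩
    obtain ⟨h1, h2, h3⟩ := H.liesOver_main hi (D.simple_neg_one r) k
    refine ⟨by omega, by omega, h1, ?_, fun S hS => ?_⟩
    · rw [h2, min_eq_right (by omega)]
    · have h4 := h3 S hS
      rwa [if_neg (by omega), if_neg (by omega), Nat.sub_eq_zero_of_le (show r ≤ k by omega), pow_zero] at h4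
  · intro j r hr hr'
    -- The hypotheses of (d) amount to `0 ≤ k ≤ r`; the case `k = 0` is `r = j - 2`, the only one
    -- with positive order.
    obtain ⟨k, rfl⟩ : ∃ k, j = r + 2 + k := ⟨j - (r + 2), by omega⟩
    obtain ⟨h1, h2, h3⟩ := H.liesOver_main hi (D.simple_neg_one r) k
    refine ⟨by omega, h1, ?_, fun S hS => ?_⟩
    · rw [h2, min_eq_left (by omega)]
      congr 1
      omega
    · have h4 := h3 S hS
      rw [if_pos (by omega)] at h4
      refine ⟨h4.1, ?_⟩
      rcases Nat.eq_zero_or_pos k with rfl | hk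
      · rw [if_neg (by omega)]
        exact h4.2
      · rw [if_pos (by omega), show 2 * r + 2 - (r + 2 + k) = r - k by omega]
        have h5 := h4.2
        rwa [if_neg hk.ne'] at h5
  · refine fun j b hb => ⟨(D.simple' j b hb).hasValue_iff, fun hj => ?_⟩
    obtain ⟨j, rfl⟩ := Nat.exists_eq_add_of_le' hj
    exact ⟨(Place.liesOver_iff j.le_succ).2 (D.imag_over hb j), D.imag_ramification hb j⟩
  · intro j hj S
    obtain ⟨j, rfl⟩ := Nat.exists_eq_add_of_le' hj
    exact D.liesOver_succ_iff S
  · refine fun j => ⟨D.injOn j, D.imag_ne j, fun b hb a ha => D.imag_eq_iff hb ha,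
      fun r hr S hS => ⟨(D.liesOver_ne hr hS).1, (D.liesOver_ne hr hS).2, fun s hs hS' => ?_⟩⟩
    exact D.liesOver_unique (by omega) (by omega) hS hS'
  · exact fun j b hb => (D.simple' j b hb).hasOrd_sq_add_one H ((sq_of_mem hb).trans hi)
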